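/- For $\alpha>0$ and $\theta>0$ let $$B(r)=\begin{cases}1-\frac{\alpha}{\theta+\alpha}r^{\theta},&0\le r\le 1,\\ \frac{\theta}{\theta+\alpha}r^{-\alpha},&r>1,\end{cases}\qquad L(t)=t^{\alpha}B(t)\quad(t>0)$$ (the local-global distinguisher covariance). A *field with covariance $B$* means a jointly measurable, mean square continuous, zero-mean, square-integrable real random field $\eta(x)$, $x\in\mathbb{R}^d$, with $\mathrm{Cov}(\eta(x),\eta(y))=B(\|x-y\|)$. An *isotropic spectral density* of $B$ in dimension $d$ is a function $f$ on $(0,\infty)$ with $u^{d-1}f(u)\in L_1(0,\infty)$ such that, for a finite measure $\Phi$ on $[0,\infty)$, $\Phi([0,z])=\frac{2\pi^{d/2}}{\Gamma(d/2)}\int_0^z u^{d-1}f(u)\,du$ for all $z\ge 0$ and $B(r)=\int_0^\infty Y_d(rz)\,\Phi(dz)$ for all $r\ge0$, where $Y_d(z)=2^{(d-2)/2}\Gamma(d/2)J_{(d-2)/2}(z)z^{(2-d)/2}$, $Y_d(0)=1$. Put $c_2(d,\alpha)=\frac{\Gamma((d-\alpha)/2)}{2^\alpha\pi^{d/2}\Gamma(\alpha/2)}$.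 (A) Let $d\in\{1,2\}$, $\alpha>0$, $0<\theta\le(3-d)/2$. Then $L(t)=\frac{\theta}{\theta+\alpha}$ for $t>1$; for all $q>0$ and $\nu\in\mathbb{R}$ there is $C$ such that for all sufficiently large $r$ and all $t\ge1$, $|1-L(tr)/L(r)|\le Ct^{\nu}/r^{q}$; and every Gaussian field with covariance $B$ satisfies Assumption 1: $B(0)=1$, and $B(r)=r^{-\alpha}L(r)$ for $r>0$ with $L$ positive, measurable and slowly varying at infinity. (B) Let $d=1$, $\alpha\in(0,1/2)$, $\theta\in(0,1]$. Then the isotropic spectral density of $B$ exists, is unique up to equality almost everywhere on $(0,\infty)$, and is given for $t=|\lambda|>0$ by $$f(t)=\frac1\pi\left(\frac{\sin t}{t}+\frac{\theta}{\theta+\alpha}\left(\frac{1}{\alpha-1}\,{}_1F_2\!\left(\tfrac12-\tfrac\alpha2;\tfrac12,\tfrac32-\tfrac\alpha2;-\tfrac{t^2}{4}\right)+t^{\alpha-1}\sin\!\left(\tfrac{\pi\alpha}{2}\right)\Gamma(1-\alpha)\right)-\frac{\alpha}{(\theta+1)(\theta+\alpha)}\,{}_1F_2\!\left(\tfrac\theta2+\tfrac12;\tfrac12,\tfrac\theta2+\tfrac32;-\tfrac{t^2}{4}\right)\right),$$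 where ${}_1F_2(a;b_1,b_2;z)=\sum_{j\ge0}\frac{(a)_j}{j!\,(b_1)_j(b_2)_j}z^j$ and $(a)_j=\Gamma(a+j)/\Gamma(a)$. As $t\to0+$, $$f(t)=\frac{\theta\,\Gamma(1-\alpha)\sin(\pi\alpha/2)}{\pi(\theta+\alpha)}t^{\alpha-1}+\frac{\alpha\theta}{\pi(1+\theta)(\alpha-1)}+o(1)\quad\text{and}\quad f(t)=c_2(1,\alpha)\frac{\theta}{\theta+\alpha}t^{\alpha-1}\left(1+O(t^{1-\alpha})\right),$$ and $f(t)=O(1/t)$ as $t\to\infty$. Moreover, every field on $\mathbb{R}$ with covariance $B$ (not necessarily Gaussian) satisfies Assumption 2 with $\upsilon=1-\alpha$, every $q>0$ and every $\nu\in\mathbb{R}$: its spectral density is $f(t)=c_2(1,\alpha)t^{\alpha-1}L(1/t)+\varepsilon(t)$ with $\varepsilon(t)=t^{\alpha-1}L(1/t)\cdot O(\min(t^{\upsilon},1))$ as $\max(t,1/t)\to\infty$, and $L$ is locally bounded on $(0,\infty)$, slowly varying at infinity, and satisfies the bound on $|1-L(tr)/L(r)|$ in (A). -/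

import Mathlib

open MeasureTheory ProbabilityTheory Filter Topology Asymptotics Set
open scoped Nat

noncomputable section

/-- The Bessel function of the first kind `J_ν(z)`, for `z > 0`. -/
def besselJ (ν z : ℝ) : ℝ :=
  ∑' k : ℕ, (-1) ^ k / ((k ! : ℝ) * Real.Gamma (k + ν + 1)) * (z / 2) ^ (2 * (k : ℝ) + ν)

/-- `Y_d(z) = 2^{(d-2)/2} Γ(d/2) J_{(d-2)/2}(z) z^{(2-d)/2}`, extended by continuity to
`Y_d(0) = 1`. -/
def sphericalY (d : ℕ) (z : ℝ) : ℝ :=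
  if z = 0 then 1
  else 2 ^ (((d : ℝ) - 2) / 2) * Real.Gamma ((d : ℝ) / 2) * besselJ (((d : ℝ) - 2) / 2) z *
    z ^ ((2 - (d : ℝ)) / 2)

/-- `Φ` is an isotropic spectral measure in dimension `d` of the covariance function `B`:
a finite measure on `[0, ∞)` with `B(r) = ∫_0^∞ Y_d(rz) dΦ(z)`. -/
structure IsIsotropicSpectralMeasure (d : ℕ) (B : ℝ → ℝ) (Φ : Measure ℝ) : Prop where
  finite : IsFiniteMeasure Φ
  null_neg : Φ (Iio 0) = 0
  repr : ∀ r : ℝ, 0 ≤ r → B r = ∫ z, sphericalY d (r * z) ∂Φ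

/-- `f` is an isotropic spectral density in dimension `d` of the covariance function `B`:
`u^{d-1} f(u)` is integrable on `(0, ∞)` and an isotropic spectral measure `Φ` of `B` satisfies
`Φ([0, z]) = 2 π^{d/2} Γ(d/2)⁻¹ ∫_0^z u^{d-1} f(u) du`. -/
structure IsIsotropicSpectralDensity (d : ℕ) (B f : ℝ → ℝ) : Prop where
  integrable : IntegrableOn (fun u : ℝ => u ^ ((d : ℝ) - 1) * f u) (Ioi 0)
  distrib : ∃ Φ : Measure ℝ, IsIsotropicSpectralMeasure d B Φ ∧
    ∀ z : ℝ, 0 ≤ z → Φ.real (Iic z) =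
      2 * Real.pi ^ ((d : ℝ) / 2) * (Real.Gamma ((d : ℝ) / 2))⁻¹ *
        ∫ u in (0 : ℝ)..z, u ^ ((d : ℝ) - 1) * f u

/-- `η` is a measurable, mean square continuous, zero-mean, homogeneous and isotropic real random
field on `ℝ^d` with covariance function `B` (a function of the distance). -/
structure IsHomogeneousIsotropicField {d : ℕ} {Ω : Type*} [MeasurableSpace Ω] (P : Measure Ω)
    (η : EuclideanSpace ℝ (Fin d) → Ω → ℝ) (B : ℝ → ℝ) : Prop where
  measurable : Measurable (Function.uncurry η)
  memLp : ∀ x, MemLp (η x) 2 P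
  meanSquareContinuous : ∀ x₀, Tendsto (fun x => ∫ ω, (η x ω - η x₀ ω) ^ 2 ∂P) (𝓝 x₀) (𝓝 0)
  mean_zero : ∀ x, ∫ ω, η x ω ∂P = 0
  covariance_eq : ∀ x y, covariance (η x) (η y) P = B (dist x y)

/-- `L : (0, ∞) → (0, ∞)` is measurable and slowly varying at infinity. -/
structure IsSlowlyVarying (L : ℝ → ℝ) : Prop where
  measurable : Measurable ((Ioi (0 : ℝ)).domRestrict L)
  pos : ∀ t : ℝ, 0 < t → 0 < L t
  tendsto : ∀ t : ℝ, 0 < t → Tendsto (fun s => L (s * t) / L s) atTop (𝓝 1)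

/-- `L` is bounded on every compact subset of `(0, ∞)`. -/
def IsLocallyBoundedOnPos (L : ℝ → ℝ) : Prop :=
  ∀ a b : ℝ, 0 < a → ∃ M : ℝ, ∀ t ∈ Icc a b, |L t| ≤ M

/-- For all sufficiently large `r`, `|1 - L(tr)/L(r)| ≤ C t^ν / r^q` for all `t ≥ 1`. -/
def HasSlowVariationRemainder (L : ℝ → ℝ) (q ν : ℝ) : Prop :=
  ∃ C : ℝ, ∀ᶠ r in atTop, ∀ t : ℝ, 1 ≤ t → |1 - L (t * r) / L r| ≤ C * t ^ ν / r ^ q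

/-- `c₂(d, α) = Γ((d-α)/2) / (2^α π^{d/2} Γ(α/2))`. -/
def cTwo (d : ℕ) (α : ℝ) : ℝ :=
  Real.Gamma (((d : ℝ) - α) / 2) / (2 ^ α * Real.pi ^ ((d : ℝ) / 2) * Real.Gamma (α / 2))

/-- The first assumption: `η` is a zero-mean homogeneous isotropic Gaussian field with `B(0) = 1`
and `B(r) = r^{-α} L(r)`, `L` slowly varying at infinity. -/
structure CovarianceAssumption {d : ℕ} {Ω : Type*} [MeasurableSpace Ω] (P : Measure Ω)
    (η : EuclideanSpace ℝ (Fin d) → Ω → ℝ) (B : ℝ → ℝ) (α : ℝ) (L : ℝ → ℝ) : Prop where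
  field : IsHomogeneousIsotropicField P η B
  gaussian : IsGaussianProcess η P
  cov_zero : B 0 = 1
  cov_eq : ∀ r : ℝ, 0 < r → B r = r ^ (-α) * L r
  slowlyVarying : IsSlowlyVarying L

/-- The second assumption: `η` has the isotropic spectral density
`f(t) = c₂(d, α) t^{α-d} L(1/t) + ε(t)`, where `ε(t) = t^{α-d} L(1/t) O(min(t^υ, 1))` as
`max(t, 1/t) → ∞` (that is, both as `t → 0+` and as `t → ∞`), and `L` is locally bounded, slowly
varying at infinity, with remainder of order `q > 0`. -/
structure SpectralAssumption {d : ℕ} {Ω : Type*} [MeasurableSpace Ω] (P : Measure Ω)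
    (η : EuclideanSpace ℝ (Fin d) → Ω → ℝ) (B f : ℝ → ℝ) (α : ℝ) (L : ℝ → ℝ)
    (υ q ν : ℝ) : Prop where
  field : IsHomogeneousIsotropicField P η B
  density : IsIsotropicSpectralDensity d B f
  expansion : ∃ ε : ℝ → ℝ,
    (∀ t : ℝ, 0 < t → f t = cTwo d α * t ^ (α - d) * L (1 / t) + ε t) ∧
    ε =O[𝓝[>] 0 ⊔ atTop] fun t : ℝ => t ^ (α - d) * L (1 / t) * min (t ^ υ) 1
  locallyBounded : IsLocallyBoundedOnPos L
  slowlyVarying : IsSlowlyVarying L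
  upsilon_pos : 0 < υ
  q_pos : 0 < q
  remainder : HasSlowVariationRemainder L q ν

/-- The generalized hypergeometric function `₁F₂(a; b₁, b₂; z) = ∑ (a)_j / (j! (b₁)_j (b₂)_j) z^j`,
`(a)_j = a (a+1) ⋯ (a+j-1)` (that is, `Γ(a+j)/Γ(a)` when `-a ∉ ℕ`). -/
def hypOneFTwo (a b₁ b₂ z : ℝ) : ℝ :=
  ∑' j : ℕ, (ascPochhammer ℝ j).eval a /
    ((j ! : ℝ) * (ascPochhammer ℝ j).eval b₁ * (ascPochhammer ℝ j).eval b₂) * z ^ j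

/-- The local-global distinguisher covariance function (of `r = ‖x‖ ≥ 0`). -/
def lgdCovariance (α θ r : ℝ) : ℝ :=
  if r ≤ 1 then 1 - α / (θ + α) * r ^ θ else θ / (θ + α) * r ^ (-α)

/-- The function `L` with `B(r) = r^{-α} L(r)`, for the local-global distinguisher `B`. -/
def lgdSlow (α θ t : ℝ) : ℝ := t ^ α * lgdCovariance α θ t

/-- The explicit spectral density of the local-global distinguisher process (`d = 1`),
at `t = ‖λ‖ > 0`. -/
def lgdSpectralDensity (α θ t : ℝ) : ℝ :=
  1 / Real.pi *
    (Real.sin t / t +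
      θ / (θ + α) *
        ((α - 1)⁻¹ * hypOneFTwo (1 / 2 - α / 2) (1 / 2) (3 / 2 - α / 2) (-t ^ 2 / 4) +
          t ^ (α - 1) * Real.sin (Real.pi * α / 2) * Real.Gamma (1 - α)) -
      α / ((θ + 1) * (θ + α)) *
        hypOneFTwo (θ / 2 + 1 / 2) (1 / 2) (θ / 2 + 3 / 2) (-t ^ 2 / 4))

end

/-!
The function `B = lgdCovariance α θ` is decreasing and convex with limit `0` at infinity, because
`θ ≤ 1` and the one-sided derivatives at `1` agree. With `w = B''` Taylor's formula at infinity
reads `B(r) = ∫₀^∞ max (s - r) 0 * w(s) ds` (`integral_max_sub_mul_lgdCurvature`), so that `B` is a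
mixture of triangle functions, as in Pólya's criterion. The triangle function is a cosine transform,
`π / 2 * max (s - r) 0 = ∫₀^∞ cos (r u) (1 - cos (s u)) / u² du`, and Fubini's theorem gives the
spectral density in the form

  `f(z) = (π z²)⁻¹ ∫₀^∞ (1 - cos (s z)) w(s) ds`

(`integrableOn_polyaDensity_and_integral_cos_mul`). Positivity of this integrand provides at once the
nonnegativity and integrability of `f`, and `1 - cos x ≤ x` provides `f(z) ≤ 1 / (π z)`.

The hypergeometric formula follows by splitting the integral at `s = 1`
(`lgdSpectralDensity_eq_polyaDensity`). On `(0, 1]`, two integrations by parts lead to the moments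
`∫₀¹ cos (z s) s ^ β ds` with `β = θ` and `β = -α`, which are `₁F₂` series by termwise integration
(`hypOneFTwo_eq_cosMoment`). The rest is the integral of `(1 - cos (s z)) s ^ (-α - 2)` over
`(0, ∞)`, which is evaluated by writing the power as a Laplace integral
(`integral_one_sub_cos_mul_rpow`) and produces the singular term `t ^ (α - 1)`. The behaviour at the
origin is read off from the continuity of the moments.

The spectral density is unique because the even extension of the spectral measure has characteristic
function `2 B(|t|)` (`IsIsotropicSpectralMeasure.real_Iic_eq`), after which Lebesgue's
differentiation theorem identifies the densities. The slow variation and the remainder condition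
hold since `L` is constant on `(1, ∞)`.
-/

/-! ### Integrals of `1 - cos` against powers -/

/-- Tonelli's theorem on the quadrant `(0, ∞)²` for a nonnegative kernel whose two marginals are
known; besides the identity of the iterated integrals it yields the joint integrability. -/
theorem integrable_prod_and_integral_eq_of_nonneg {F : ℝ → ℝ → ℝ} {A b : ℝ → ℝ}
    (hF : Measurable (Function.uncurry F)) (h0 : ∀ x, 0 < x → ∀ y, 0 < y → 0 ≤ F x y)
    (hA : ∀ x, 0 < x → ∫ y in Ioi (0 : ℝ), F x y = A x)
    (hint : ∀ y, 0 < y → IntegrableOn (fun x => F x y) (Ioi 0))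
    (hb : ∀ y, 0 < y → ∫ x in Ioi (0 : ℝ), F x y = b y)
    (hbi : IntegrableOn b (Ioi 0)) :
    Integrable (Function.uncurry F)
        ((volume.restrict (Ioi (0 : ℝ))).prod (volume.restrict (Ioi (0 : ℝ)))) ∧
      IntegrableOn A (Ioi 0) ∧ ∫ x in Ioi (0 : ℝ), A x = ∫ y in Ioi (0 : ℝ), b y := by
  have hprod : Integrable (Function.uncurry F)
      ((volume.restrict (Ioi (0 : ℝ))).prod (volume.restrict (Ioi (0 : ℝ)))) := by
    rw [integrable_prod_iff' hF.aestronglyMeasurable]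
    refine ⟨?_, ?_⟩
    · filter_upwards [ae_restrict_mem measurableSet_Ioi] with y hy using hint y hy
    · refine IntegrableOn.congr_fun hbi (fun y hy => ?_) measurableSet_Ioi
      rw [← hb y hy]
      refine setIntegral_congr_fun measurableSet_Ioi fun x hx => ?_
      exact (Real.norm_of_nonneg (h0 x hx y hy)).symm
  refine ⟨hprod, ?_, ?_⟩
  · refine IntegrableOn.congr_fun (f := fun x => ∫ y in Ioi (0 : ℝ), F x y)
      hprod.integral_prod_left (fun x hx => hA x hx) measurableSet_Ioi
  · rw [← setIntegral_congr_fun measurableSet_Ioi (fun x hx => hA x hx),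
      ← setIntegral_congr_fun measurableSet_Ioi (fun y hy => hb y hy)]
    exact integral_integral_swap hprod

theorem integral_rpow_div_one_add_sq {q : ℝ} (h1 : -1 < q) (h2 : q < 1) :
    IntegrableOn (fun x : ℝ => x ^ q / (1 + x ^ 2)) (Ioi 0) ∧
      ∫ x in Ioi (0 : ℝ), x ^ q / (1 + x ^ 2) = Real.pi / (2 * Real.cos (Real.pi * q / 2)) := by
  have hbase : IntegrableOn (fun y : ℝ => Real.exp (-y) * y ^ ((1 - q) / 2 - 1)) (Ioi 0) :=
    Real.GammaIntegral_convergent (by linarith)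
  -- `1 / (1 + x ^ 2)` is the Laplace integral of `exp (-y * (1 + x ^ 2))`
  obtain ⟨-, hi, he⟩ := integrable_prod_and_integral_eq_of_nonneg
    (F := fun x y => x ^ q * Real.exp (-y * x ^ (2 : ℝ)) * Real.exp (-y))
    (A := fun x => x ^ q / (1 + x ^ 2))
    (b := fun y => 1 / 2 * Real.Gamma ((q + 1) / 2) *
      (Real.exp (-y) * y ^ ((1 - q) / 2 - 1)))
    (by fun_prop) (fun x hx y hy => by positivity)
    (fun x hx => by
      have : ∀ y : ℝ, x ^ q * Real.exp (-y * x ^ (2 : ℝ)) * Real.exp (-y)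
          = x ^ q * Real.exp (-(1 + x ^ 2) * y) := fun y => by
        rw [mul_assoc, ← Real.exp_add, Real.rpow_two]; ring_nf
      simp only [this]
      have hneg : -(1 + x ^ 2) < 0 := by nlinarith [sq_nonneg x]
      rw [integral_const_mul, integral_exp_mul_Ioi hneg]
      simp only [mul_zero, Real.exp_zero, neg_div_neg_eq]
      rw [mul_one_div])
    (fun y hy => (integrableOn_rpow_mul_exp_neg_mul_rpow h1 (by norm_num) hy).mul_const _)
    (fun y hy => by
      rw [integral_mul_const, integral_rpow_mul_exp_neg_mul_rpow (by norm_num) h1 hy]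
      rw [show -(q + 1) / 2 = (1 - q) / 2 - 1 by ring]; ring)
    (hbase.const_mul _)
  refine ⟨hi, he.trans ?_⟩
  rw [integral_const_mul, ← Real.Gamma_eq_integral (by linarith), mul_assoc,
    show (1 - q) / 2 = 1 - (q + 1) / 2 by ring, Real.Gamma_mul_Gamma_one_sub,
    show Real.pi * ((q + 1) / 2) = Real.pi * q / 2 + Real.pi / 2 by ring, Real.sin_add_pi_div_two]
  rw [div_mul_div_comm, one_mul]

theorem integral_one_sub_cos_mul_exp_neg {x : ℝ} (hx : 0 < x) :
    IntegrableOn (fun u : ℝ => (1 - Real.cos u) * Real.exp (-(x * u))) (Ioi 0) ∧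
      ∫ u in Ioi (0 : ℝ), (1 - Real.cos u) * Real.exp (-(x * u)) = 1 / x - x / (1 + x ^ 2) := by
  set G : ℝ → ℝ := fun u =>
    (-1 / x - (Real.sin u - x * Real.cos u) / (1 + x ^ 2)) * Real.exp (-(x * u)) with hG
  have hden : (1 + x ^ 2) ≠ 0 := by positivity
  have hd : ∀ u : ℝ, HasDerivAt G ((1 - Real.cos u) * Real.exp (-(x * u))) u := fun u => by
    have h1 : HasDerivAt (fun u : ℝ => Real.exp (-(x * u))) (Real.exp (-(x * u)) * (-(x * 1))) u :=
      (((hasDerivAt_id u).const_mul x).neg).exp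
    have h2 := ((((Real.hasDerivAt_sin u).sub ((Real.hasDerivAt_cos u).const_mul x)).div_const
      (1 + x ^ 2)).const_sub (-1 / x)).mul h1
    refine h2.congr_deriv ?_
    simp only [Pi.sub_apply]
    field_simp
    ring
  have hexp : Tendsto (fun u : ℝ => Real.exp (-(x * u))) atTop (𝓝 0) :=
    Real.tendsto_exp_neg_atTop_nhds_zero.comp (tendsto_id.const_mul_atTop hx)
  have hlim : Tendsto G atTop (𝓝 0) := by
    refine squeeze_zero_norm (a := fun u => (1 / x + (1 + x) / (1 + x ^ 2)) * Real.exp (-(x * u)))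
      (fun u => ?_) (by simpa using hexp.const_mul (1 / x + (1 + x) / (1 + x ^ 2)))
    rw [hG, norm_mul, Real.norm_of_nonneg (Real.exp_pos _).le]
    refine mul_le_mul_of_nonneg_right ?_ (Real.exp_pos _).le
    refine (norm_sub_le _ _).trans (add_le_add ?_ ?_)
    · rw [norm_div, norm_neg, norm_one, Real.norm_of_nonneg hx.le]
    · rw [norm_div, Real.norm_of_nonneg (show 0 ≤ 1 + x ^ 2 by positivity)]
      refine div_le_div_of_nonneg_right ?_ (by positivity)
      refine (norm_sub_le _ _).trans (add_le_add (Real.abs_sin_le_one u) ?_)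
      rw [norm_mul, Real.norm_of_nonneg hx.le]
      exact mul_le_of_le_one_right hx.le (Real.abs_cos_le_one u)
  have hnn : ∀ u ∈ Ioi (0 : ℝ), 0 ≤ (1 - Real.cos u) * Real.exp (-(x * u)) := fun u _ =>
    mul_nonneg (sub_nonneg.2 (Real.cos_le_one u)) (Real.exp_pos _).le
  refine ⟨integrableOn_Ioi_deriv_of_nonneg' (fun u _ => hd u) hnn hlim, ?_⟩
  rw [integral_Ioi_of_hasDerivAt_of_nonneg' (fun u _ => hd u) hnn hlim]
  simp [hG]
  field_simp
  ring

theorem integral_one_sub_cos_mul_rpow {p : ℝ} (h1 : 1 < p) (h3 : p < 3) :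
    IntegrableOn (fun u : ℝ => (1 - Real.cos u) * u ^ (-p)) (Ioi 0) ∧
      ∫ u in Ioi (0 : ℝ), (1 - Real.cos u) * u ^ (-p) =
        Real.pi / (2 * Real.Gamma p * Real.cos (Real.pi * (p - 2) / 2)) := by
  have hΓ : 0 < Real.Gamma p := Real.Gamma_pos_of_pos (by linarith)
  obtain ⟨hqi, hq⟩ := integral_rpow_div_one_add_sq (q := p - 2) (by linarith) (by linarith)
  -- `u ^ (-p)` is a Laplace integral as well
  obtain ⟨-, hi, he⟩ := integrable_prod_and_integral_eq_of_nonneg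
    (F := fun u x => (Real.Gamma p)⁻¹ * x ^ (p - 1) * ((1 - Real.cos u) * Real.exp (-(x * u))))
    (A := fun u => (1 - Real.cos u) * u ^ (-p))
    (b := fun x => (Real.Gamma p)⁻¹ * (x ^ (p - 2) / (1 + x ^ 2)))
    (by fun_prop)
    (fun u hu x hx => mul_nonneg (by positivity)
      (mul_nonneg (sub_nonneg.2 (Real.cos_le_one u)) (Real.exp_pos _).le))
    (fun u hu => by
      have : ∀ x : ℝ, (Real.Gamma p)⁻¹ * x ^ (p - 1) * ((1 - Real.cos u) * Real.exp (-(x * u)))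
          = (Real.Gamma p)⁻¹ * (1 - Real.cos u) * (x ^ (p - 1) * Real.exp (-(u * x))) :=
        fun x => by rw [mul_comm x u]; ring
      simp only [this]
      rw [integral_const_mul, Real.integral_rpow_mul_exp_neg_mul_Ioi (by linarith) hu, one_div,
        Real.inv_rpow hu.le, ← Real.rpow_neg hu.le]
      field_simp)
    (fun x hx => (integral_one_sub_cos_mul_exp_neg hx).1.const_mul _)
    (fun x hx => by
      rw [integral_const_mul, (integral_one_sub_cos_mul_exp_neg hx).2,
        show p - 1 = (p - 2) + 1 by ring, Real.rpow_add_one hx.ne']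
      have : (1 + x ^ 2) ≠ 0 := by positivity
      field_simp
      ring)
    (hqi.const_mul _)
  refine ⟨hi, he.trans ?_⟩
  rw [integral_const_mul, hq]
  rw [inv_mul_eq_div, div_div]
  congr 1
  ring

theorem integral_one_sub_cos_mul_mul_rpow {p a : ℝ} (h1 : 1 < p) (h3 : p < 3) (ha : 0 < a) :
    IntegrableOn (fun u : ℝ => (1 - Real.cos (a * u)) * u ^ (-p)) (Ioi 0) ∧
      ∫ u in Ioi (0 : ℝ), (1 - Real.cos (a * u)) * u ^ (-p) =
        a ^ (p - 1) * (Real.pi / (2 * Real.Gamma p * Real.cos (Real.pi * (p - 2) / 2))) := by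
  obtain ⟨hi, he⟩ := integral_one_sub_cos_mul_rpow h1 h3
  have hcongr : ∀ u ∈ Ioi (0 : ℝ), a ^ p * ((1 - Real.cos (a * u)) * (a * u) ^ (-p)) =
      (1 - Real.cos (a * u)) * u ^ (-p) := fun u hu => by
    rw [Real.mul_rpow ha.le (le_of_lt hu), Real.rpow_neg ha.le]
    have := (Real.rpow_pos_of_pos ha p).ne'
    field_simp
  have hi' : IntegrableOn (fun u : ℝ => (1 - Real.cos (a * u)) * (a * u) ^ (-p)) (Ioi 0) := by
    rw [integrableOn_Ioi_comp_mul_left_iff (fun u : ℝ => (1 - Real.cos u) * u ^ (-p)) 0 ha]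
    simpa using hi
  refine ⟨IntegrableOn.congr_fun (hi'.const_mul (a ^ p)) hcongr measurableSet_Ioi, ?_⟩
  rw [← setIntegral_congr_fun measurableSet_Ioi hcongr, integral_const_mul,
    integral_comp_mul_left_Ioi (fun u : ℝ => (1 - Real.cos u) * u ^ (-p)) 0 ha, mul_zero, he,
    Real.rpow_sub_one ha.ne', smul_eq_mul]
  ring

/-- The case `p = 2`; it is the Fourier transform behind the triangle function. -/
theorem integral_one_sub_cos_div_sq (a : ℝ) :
    IntegrableOn (fun u : ℝ => (1 - Real.cos (a * u)) / u ^ 2) (Ioi 0) ∧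
      ∫ u in Ioi (0 : ℝ), (1 - Real.cos (a * u)) / u ^ 2 = Real.pi / 2 * |a| := by
  wlog ha : 0 < a generalizing a
  · rcases eq_or_ne a 0 with rfl | h0
    · simp
    · simpa using this (-a) (by grind)
  obtain ⟨hi, he⟩ := integral_one_sub_cos_mul_mul_rpow (p := 2) (by norm_num) (by norm_num) ha
  have hcongr : ∀ u ∈ Ioi (0 : ℝ), (1 - Real.cos (a * u)) * u ^ (-2 : ℝ) =
      (1 - Real.cos (a * u)) / u ^ 2 := fun u hu => by
    rw [Real.rpow_neg (le_of_lt hu), Real.rpow_two, div_eq_mul_inv]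
  refine ⟨IntegrableOn.congr_fun hi hcongr measurableSet_Ioi, ?_⟩
  rw [← setIntegral_congr_fun measurableSet_Ioi hcongr, he, abs_of_pos ha]
  norm_num
  ring

theorem integral_cos_mul_one_sub_cos_div_sq {r s : ℝ} (hr : 0 ≤ r) (hs : 0 ≤ s) :
    ∫ u in Ioi (0 : ℝ), Real.cos (r * u) * ((1 - Real.cos (s * u)) / u ^ 2) =
      Real.pi / 2 * max (s - r) 0 := by
  -- product to sum: the integrand is a combination of terms `(1 - cos (a * u)) / u ^ 2`
  have hsum : ∀ u : ℝ, Real.cos (r * u) * ((1 - Real.cos (s * u)) / u ^ 2) =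
      (1 / 2) * ((1 - Real.cos ((s + r) * u)) / u ^ 2) +
        (1 / 2) * ((1 - Real.cos ((s - r) * u)) / u ^ 2) - (1 - Real.cos (r * u)) / u ^ 2 :=
    fun u => by rw [add_mul, sub_mul, Real.cos_add, Real.cos_sub]; ring
  simp only [hsum]
  have h1 := integral_one_sub_cos_div_sq (s + r)
  have h2 := integral_one_sub_cos_div_sq (s - r)
  have h3 := integral_one_sub_cos_div_sq r
  have h12 := (h1.1.const_mul (1 / 2)).add (h2.1.const_mul (1 / 2))
  refine (integral_sub h12 h3.1).trans ?_
  simp only [Pi.add_apply]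
  rw [integral_add (h1.1.const_mul (1 / 2)) (h2.1.const_mul (1 / 2)), integral_const_mul,
    integral_const_mul, h1.2, h2.2, h3.2, abs_of_nonneg hr, abs_of_nonneg (add_nonneg hs hr)]
  rcases le_total r s with h | h
  · rw [abs_of_nonneg (by linarith), max_eq_left (by linarith)]; ring
  · rw [abs_of_nonpos (by linarith), max_eq_right (by linarith)]; ring

/-! ### Mixtures of triangle functions -/

/-- The density `z ↦ (π z²)⁻¹ ∫₀^∞ (1 - cos (s z)) w(s) ds` of a mixture of triangle functions
`r ↦ max (s - r) 0` with mixing weights `w(s)`. -/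
noncomputable def polyaDensity (w : ℝ → ℝ) (z : ℝ) : ℝ :=
  (Real.pi * z ^ 2)⁻¹ * ∫ s in Ioi (0 : ℝ), (1 - Real.cos (s * z)) * w s

theorem polyaDensity_nonneg {w : ℝ → ℝ} (h0 : ∀ s, 0 < s → 0 ≤ w s) (z : ℝ) :
    0 ≤ polyaDensity w z :=
  mul_nonneg (by positivity) (setIntegral_nonneg measurableSet_Ioi fun s hs =>
    mul_nonneg (sub_nonneg.2 (Real.cos_le_one _)) (h0 s hs))

theorem one_sub_cos_le_self {x : ℝ} (hx : 0 ≤ x) : 1 - Real.cos x ≤ x := by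
  rcases le_total x 2 with h | h
  · nlinarith [Real.one_sub_sq_div_two_le_cos (x := x)]
  · linarith [Real.neg_one_le_cos x]

theorem integrableOn_one_sub_cos_mul {w : ℝ → ℝ} (hw : Measurable w)
    (h0 : ∀ s, 0 < s → 0 ≤ w s) (hsw : IntegrableOn (fun s => s * w s) (Ioi 0)) {z : ℝ}
    (hz : 0 ≤ z) : IntegrableOn (fun s => (1 - Real.cos (s * z)) * w s) (Ioi 0) := by
  refine Integrable.mono' (hsw.const_mul z) (by fun_prop) ?_
  filter_upwards [ae_restrict_mem measurableSet_Ioi] with s hs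
  have hs' : 0 < s := hs
  rw [Real.norm_of_nonneg (mul_nonneg (sub_nonneg.2 (Real.cos_le_one _)) (h0 s hs))]
  calc (1 - Real.cos (s * z)) * w s ≤ (s * z) * w s :=
        mul_le_mul_of_nonneg_right (one_sub_cos_le_self (by positivity)) (h0 s hs)
    _ = z * (s * w s) := by ring

theorem polyaDensity_le {w : ℝ → ℝ} (hw : Measurable w)
    (h0 : ∀ s, 0 < s → 0 ≤ w s) (hsw : IntegrableOn (fun s => s * w s) (Ioi 0)) {z : ℝ}
    (hz : 0 < z) : polyaDensity w z ≤ (Real.pi * z)⁻¹ * ∫ s in Ioi (0 : ℝ), s * w s := by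
  have : ∫ s in Ioi (0 : ℝ), (1 - Real.cos (s * z)) * w s ≤ ∫ s in Ioi (0 : ℝ), z * (s * w s) := by
    refine setIntegral_mono_on (integrableOn_one_sub_cos_mul hw h0 hsw hz.le) (hsw.const_mul z)
      measurableSet_Ioi fun s hs => ?_
    have hs' : 0 < s := hs
    calc (1 - Real.cos (s * z)) * w s ≤ (s * z) * w s :=
          mul_le_mul_of_nonneg_right (one_sub_cos_le_self (by positivity)) (h0 s hs)
      _ = z * (s * w s) := by ring
  rw [integral_const_mul] at this
  calc polyaDensity w z ≤ (Real.pi * z ^ 2)⁻¹ * (z * ∫ s in Ioi (0 : ℝ), s * w s) :=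
        mul_le_mul_of_nonneg_left this (by positivity)
    _ = _ := by field_simp

/-- Fourier inversion for mixtures of triangle functions. Nonnegativity makes Fubini's theorem
available, so that no regularity of the density has to be known beforehand. -/
theorem integrableOn_polyaDensity_and_integral_cos_mul {w : ℝ → ℝ} (hw : Measurable w)
    (h0 : ∀ s, 0 < s → 0 ≤ w s) (hsw : IntegrableOn (fun s => s * w s) (Ioi 0)) :
    IntegrableOn (polyaDensity w) (Ioi 0) ∧
      ∀ r, 0 ≤ r → ∫ z in Ioi (0 : ℝ), Real.cos (r * z) * polyaDensity w z =
        1 / 2 * ∫ s in Ioi (0 : ℝ), max (s - r) 0 * w s := by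
  have hA : ∀ z : ℝ, ∫ s in Ioi (0 : ℝ), Real.pi⁻¹ * w s * ((1 - Real.cos (s * z)) / z ^ 2) =
      polyaDensity w z := fun z => by
    rw [polyaDensity, ← integral_const_mul]
    refine integral_congr_ae (Eventually.of_forall fun s => ?_)
    simp only [div_eq_mul_inv, mul_inv]
    ring
  obtain ⟨hprod, hi, -⟩ := integrable_prod_and_integral_eq_of_nonneg
    (F := fun z s => Real.pi⁻¹ * w s * ((1 - Real.cos (s * z)) / z ^ 2))
    (A := polyaDensity w) (b := fun s => 1 / 2 * (s * w s)) (by fun_prop)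
    (fun z hz s hs => mul_nonneg (mul_nonneg (by positivity) (h0 s hs))
      (div_nonneg (sub_nonneg.2 (Real.cos_le_one _)) (by positivity)))
    (fun z _ => hA z)
    (fun s _ => (integral_one_sub_cos_div_sq s).1.const_mul _)
    (fun s hs => by
      rw [integral_const_mul, (integral_one_sub_cos_div_sq s).2, abs_of_pos hs]
      field_simp)
    (hsw.const_mul _)
  refine ⟨hi, fun r hr => ?_⟩
  have hcos : Integrable (Function.uncurry fun z s : ℝ =>
      Real.cos (r * z) * (Real.pi⁻¹ * w s * ((1 - Real.cos (s * z)) / z ^ 2)))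
      ((volume.restrict (Ioi (0 : ℝ))).prod (volume.restrict (Ioi (0 : ℝ)))) := by
    refine hprod.mono (Measurable.aestronglyMeasurable (by fun_prop))
      (Eventually.of_forall fun p => ?_)
    simp only [Function.uncurry, norm_mul (Real.cos _)]
    exact mul_le_of_le_one_left (norm_nonneg _) (Real.abs_cos_le_one _)
  have hswap := integral_integral_swap hcos
  simp only [integral_const_mul, hA] at hswap
  rw [hswap, ← integral_const_mul]
  refine setIntegral_congr_fun measurableSet_Ioi fun s hs => ?_
  have : ∀ z : ℝ, Real.cos (r * z) * (Real.pi⁻¹ * w s * ((1 - Real.cos (s * z)) / z ^ 2)) =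
      Real.pi⁻¹ * w s * (Real.cos (r * z) * ((1 - Real.cos (s * z)) / z ^ 2)) := fun z => by ring
  simp only [this]
  rw [integral_const_mul, integral_cos_mul_one_sub_cos_div_sq hr (le_of_lt hs)]
  field_simp

/-! ### The covariance function as a mixture of triangle functions -/

/-- The second derivative of `lgdCovariance α θ` on `(0, ∞)` away from the kink at `1`; the first
derivative is continuous at `1`, so that no atom arises there. -/
noncomputable def lgdCurvature (α θ s : ℝ) : ℝ :=
  α * θ / (θ + α) * if s ≤ 1 then (1 - θ) * s ^ (θ - 2) else (1 + α) * s ^ (-α - 2)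

theorem measurable_lgdCurvature (α θ : ℝ) : Measurable (lgdCurvature α θ) :=
  (Measurable.ite measurableSet_Iic (by fun_prop) (by fun_prop)).const_mul _

theorem lgdCurvature_nonneg {α θ : ℝ} (hα : 0 < α) (hθ : 0 < θ) (hθ1 : θ ≤ 1) {s : ℝ}
    (hs : 0 < s) : 0 ≤ lgdCurvature α θ s := by
  have : 0 ≤ 1 - θ := by linarith
  unfold lgdCurvature
  split_ifs <;> positivity

theorem integral_Ioi_sub_mul_rpow {α r c : ℝ} (hα : 0 < α) (hc : 0 < c) (hrc : r ≤ c) :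
    IntegrableOn (fun s : ℝ => (s - r) * ((1 + α) * s ^ (-α - 2))) (Ioi c) ∧
      ∫ s in Ioi c, (s - r) * ((1 + α) * s ^ (-α - 2)) =
        (1 + α) / α * c ^ (-α) - r * c ^ (-α - 1) := by
  set G : ℝ → ℝ := fun s => -((1 + α) / α) * s ^ (-α) + r * s ^ (-α - 1)
  have hd : ∀ s ∈ Ici c, HasDerivAt G ((s - r) * ((1 + α) * s ^ (-α - 2))) s := fun s hs => by
    have hs0 : 0 < s := hc.trans_le hs
    refine (((Real.hasDerivAt_rpow_const (Or.inl hs0.ne')).const_mul _).add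
      ((Real.hasDerivAt_rpow_const (Or.inl hs0.ne')).const_mul _)).congr_deriv ?_
    rw [show -α - 1 = (-α - 2) + 1 by ring, Real.rpow_add_one hs0.ne',
      show -α - 2 + 1 - 1 = -α - 2 by ring]
    field_simp
    ring
  have hnn : ∀ s ∈ Ioi c, 0 ≤ (s - r) * ((1 + α) * s ^ (-α - 2)) := fun s hs => by
    have hs0 : 0 < s := hc.trans hs
    have : 0 ≤ s - r := sub_nonneg.2 (hrc.trans (le_of_lt hs))
    positivity
  have hlim : Tendsto G atTop (𝓝 0) := by
    have h2 : Tendsto (fun s : ℝ => s ^ (-α - 1)) atTop (𝓝 0) := by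
      simpa only [neg_add'] using tendsto_rpow_neg_atTop (show 0 < α + 1 by linarith)
    simpa [G] using ((tendsto_rpow_neg_atTop hα).const_mul (-((1 + α) / α))).add (h2.const_mul r)
  refine ⟨integrableOn_Ioi_deriv_of_nonneg' hd hnn hlim, ?_⟩
  rw [integral_Ioi_of_hasDerivAt_of_nonneg' hd hnn hlim]
  simp only [G]
  ring

theorem integral_Ioc_sub_mul_rpow {θ r : ℝ} (hθ : 0 < θ) (hθ1 : θ ≤ 1) (hr : 0 ≤ r) (hr1 : r ≤ 1) :
    IntegrableOn (fun s : ℝ => (s - r) * ((1 - θ) * s ^ (θ - 2))) (Ioc r 1) ∧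
      ∫ s in Ioc r 1, (s - r) * ((1 - θ) * s ^ (θ - 2)) = (1 - θ) / θ + r - r ^ θ / θ := by
  set G : ℝ → ℝ := fun s => (1 - θ) / θ * s ^ θ + r * s ^ (θ - 1) with hG
  have hd : ∀ s ∈ Ioo r 1, HasDerivAt G ((s - r) * ((1 - θ) * s ^ (θ - 2))) s := fun s hs => by
    have hs0 : 0 < s := hr.trans_lt hs.1
    refine (((Real.hasDerivAt_rpow_const (Or.inl hs0.ne')).const_mul _).add
      ((Real.hasDerivAt_rpow_const (Or.inl hs0.ne')).const_mul _)).congr_deriv ?_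
    rw [show θ - 1 = (θ - 2) + 1 by ring, Real.rpow_add_one hs0.ne',
      show θ - 2 + 1 - 1 = θ - 2 by ring]
    field_simp
    ring
  have hnn : ∀ s ∈ Ioo r 1, 0 ≤ (s - r) * ((1 - θ) * s ^ (θ - 2)) := fun s hs => by
    have hs0 : 0 < s := hr.trans_lt hs.1
    have : 0 ≤ s - r := sub_nonneg.2 hs.1.le
    have : 0 ≤ 1 - θ := by linarith
    positivity
  have hcont : ContinuousOn G (Icc r 1) := by
    refine ContinuousOn.add (continuousOn_const.mul
      (Real.continuous_rpow_const hθ.le).continuousOn) ?_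
    rcases hr.eq_or_lt with rfl | hr0
    · simpa using continuousOn_const
    · exact continuousOn_const.mul (continuousOn_id.rpow_const
        fun s hs => Or.inl (hr0.trans_le hs.1).ne')
  have hi := intervalIntegral.integrableOn_deriv_of_nonneg hcont hd hnn
  refine ⟨hi, ?_⟩
  rw [← intervalIntegral.integral_of_le hr1,
    intervalIntegral.integral_eq_sub_of_hasDerivAt_of_le hr1 hcont hd
      ((intervalIntegrable_iff_integrableOn_Ioc_of_le hr1).2 hi)]
  have hrθ : r * r ^ (θ - 1) = r ^ θ := by
    rcases hr.eq_or_lt with rfl | hr0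
    · simp [hθ.ne']
    · rw [Real.rpow_sub_one hr0.ne', mul_div_cancel₀ _ hr0.ne']
  simp only [hG, Real.one_rpow, hrθ]
  field_simp
  ring

/-- `lgdCovariance α θ` is a mixture of triangle functions: it is convex and vanishes at infinity,
hence recovered from its second derivative by Taylor's formula at infinity. -/
theorem integral_max_sub_mul_lgdCurvature {α θ r : ℝ} (hα : 0 < α) (hθ : 0 < θ) (hθ1 : θ ≤ 1)
    (hr : 0 ≤ r) :
    IntegrableOn (fun s => max (s - r) 0 * lgdCurvature α θ s) (Ioi 0) ∧
      ∫ s in Ioi (0 : ℝ), max (s - r) 0 * lgdCurvature α θ s = lgdCovariance α θ r := by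
  have hK : θ + α ≠ 0 := by positivity
  suffices h : IntegrableOn (fun s => max (s - r) 0 * lgdCurvature α θ s) (Ioi r) ∧
      ∫ s in Ioi r, max (s - r) 0 * lgdCurvature α θ s = lgdCovariance α θ r by
    have hzero : ∀ s ∈ Ioi (0 : ℝ) \ Ioi r, max (s - r) 0 * lgdCurvature α θ s = 0 :=
      fun s hs => by
        have : s ≤ r := not_lt.1 hs.2
        rw [max_eq_right (by linarith), zero_mul]
    refine ⟨h.1.of_forall_sdiff_eq_zero measurableSet_Ioi hzero, ?_⟩
    rw [← h.2]
    exact setIntegral_eq_of_subset_of_forall_sdiff_eq_zero measurableSet_Ioi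
      (Ioi_subset_Ioi hr) hzero
  -- the integral starts at `r`, on either side of the kink at `1`
  have hfar : ∀ c, 1 ≤ c → r ≤ c → ∀ s ∈ Ioi c, α * θ / (θ + α) *
      ((s - r) * ((1 + α) * s ^ (-α - 2))) = max (s - r) 0 * lgdCurvature α θ s :=
    fun c hc hrc s hs => by
      have hs' : c < s := hs
      rw [max_eq_left (by linarith), lgdCurvature, if_neg (by linarith)]
      ring
  rcases le_total 1 r with h1 | h1
  · have hI := integral_Ioi_sub_mul_rpow hα (zero_lt_one.trans_le h1) le_rfl
    refine ⟨IntegrableOn.congr_fun (hI.1.const_mul _) (hfar r h1 le_rfl) measurableSet_Ioi, ?_⟩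
    rw [← setIntegral_congr_fun measurableSet_Ioi (hfar r h1 le_rfl), integral_const_mul, hI.2]
    have hr0 : 0 < r := by linarith
    rw [Real.rpow_sub_one hr0.ne', lgdCovariance]
    rcases h1.eq_or_lt with rfl | h1'
    · simp only [le_refl, if_true, Real.one_rpow]
      field_simp
      ring
    · rw [if_neg (not_le.2 h1')]
      field_simp
      ring
  · have hI := integral_Ioc_sub_mul_rpow hθ hθ1 hr h1
    have hJ := integral_Ioi_sub_mul_rpow hα zero_lt_one h1
    have hnear : ∀ s ∈ Ioc r 1, α * θ / (θ + α) *
        ((s - r) * ((1 - θ) * s ^ (θ - 2))) = max (s - r) 0 * lgdCurvature α θ s := fun s hs => by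
      rw [max_eq_left (by linarith [hs.1]), lgdCurvature, if_pos hs.2]
      ring
    have hi1 := IntegrableOn.congr_fun (hI.1.const_mul _) hnear measurableSet_Ioc
    have hi2 := IntegrableOn.congr_fun (hJ.1.const_mul _) (hfar 1 le_rfl h1) measurableSet_Ioi
    rw [← Ioc_union_Ioi_eq_Ioi h1]
    refine ⟨hi1.union hi2, ?_⟩
    rw [setIntegral_union (Ioc_disjoint_Ioi le_rfl) measurableSet_Ioi hi1 hi2,
      ← setIntegral_congr_fun measurableSet_Ioc hnear,
      ← setIntegral_congr_fun measurableSet_Ioi (hfar 1 le_rfl h1), integral_const_mul,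
      integral_const_mul, hI.2, hJ.2, lgdCovariance, if_pos h1]
    simp only [Real.one_rpow]
    field_simp
    ring

theorem integral_mul_lgdCurvature {α θ : ℝ} (hα : 0 < α) (hθ : 0 < θ) (hθ1 : θ ≤ 1) :
    IntegrableOn (fun s => s * lgdCurvature α θ s) (Ioi 0) ∧
      ∫ s in Ioi (0 : ℝ), s * lgdCurvature α θ s = 1 := by
  have hcongr : ∀ s ∈ Ioi (0 : ℝ), max (s - 0) 0 * lgdCurvature α θ s = s * lgdCurvature α θ s :=
    fun s hs => by rw [sub_zero, max_eq_left (le_of_lt hs)]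
  obtain ⟨hi, he⟩ := integral_max_sub_mul_lgdCurvature (r := 0) hα hθ hθ1 le_rfl
  refine ⟨IntegrableOn.congr_fun hi hcongr measurableSet_Ioi, ?_⟩
  rw [← setIntegral_congr_fun measurableSet_Ioi hcongr, he]
  simp [lgdCovariance, hθ.ne']

/-! ### Cosine moments and hypergeometric series -/

theorem factorial_mul_ascPochhammer_half (j : ℕ) :
    (j ! : ℝ) * (ascPochhammer ℝ j).eval (1 / 2) * 4 ^ j = ((2 * j)! : ℝ) := by
  induction j with
  | zero => simp
  | succ j ih =>
    rw [show 2 * (j + 1) = 2 * j + 1 + 1 by ring, Nat.factorial_succ (2 * j + 1),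
      Nat.factorial_succ (2 * j), Nat.factorial_succ j, ascPochhammer_succ_eval]
    push_cast
    rw [← ih]
    ring

theorem ascPochhammer_eval_mul_add (a : ℝ) (j : ℕ) :
    (ascPochhammer ℝ j).eval a * (a + j) = a * (ascPochhammer ℝ j).eval (a + 1) := by
  rw [← ascPochhammer_succ_eval, ascPochhammer_succ_left]
  simp [Polynomial.eval_comp]

theorem hypOneFTwo_term_eq {a : ℝ} (ha : 0 < a) (t : ℝ) (j : ℕ) :
    (ascPochhammer ℝ j).eval a /
      ((j ! : ℝ) * (ascPochhammer ℝ j).eval (1 / 2) * (ascPochhammer ℝ j).eval (a + 1)) *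
        (-t ^ 2 / 4) ^ j = a / (a + j) * ((-1) ^ j * t ^ (2 * j) / ((2 * j)! : ℝ)) := by
  have h1 := factorial_mul_ascPochhammer_half j
  have h2 := ascPochhammer_eval_mul_add a j
  have h3 : (ascPochhammer ℝ j).eval (a + 1) ≠ 0 := (ascPochhammer_pos j _ (by linarith)).ne'
  have h4 : (ascPochhammer ℝ j).eval (1 / 2 : ℝ) ≠ 0 := (ascPochhammer_pos j _ (by norm_num)).ne'
  have h5 : a + j ≠ 0 := by positivity
  have h6 : (j ! : ℝ) ≠ 0 := by positivity
  rw [← h1, show -t ^ 2 / 4 = (-1) * t ^ 2 / 4 by ring, div_pow, mul_pow, ← pow_mul,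
    eq_div_of_mul_eq h5 h2]
  field_simp

/-- The truncated cosine moment `∫₀¹ cos (t s) s ^ β ds`. -/
noncomputable def cosMoment (β t : ℝ) : ℝ := ∫ s in (0 : ℝ)..1, Real.cos (t * s) * s ^ β

theorem norm_cos_mul_rpow_le (t : ℝ) {β s : ℝ} (hs : 0 < s) :
    ‖Real.cos (t * s) * s ^ β‖ ≤ s ^ β := by
  rw [norm_mul, Real.norm_of_nonneg (Real.rpow_nonneg hs.le β)]
  exact mul_le_of_le_one_left (Real.rpow_nonneg hs.le β) (Real.abs_cos_le_one _)

theorem intervalIntegrable_cos_mul_rpow {β : ℝ} (hβ : -1 < β) (t : ℝ) :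
    IntervalIntegrable (fun s : ℝ => Real.cos (t * s) * s ^ β) volume 0 1 :=
  (intervalIntegral.intervalIntegrable_rpow' hβ).continuousOn_mul
    (Continuous.continuousOn (by fun_prop))

theorem continuous_cosMoment {β : ℝ} (hβ : -1 < β) : Continuous (cosMoment β) := by
  refine intervalIntegral.continuous_of_dominated_interval (bound := fun s => s ^ β)
    (fun t => Measurable.aestronglyMeasurable (by fun_prop))
    (fun t => Eventually.of_forall fun s hs => ?_)
    (intervalIntegral.intervalIntegrable_rpow' hβ) (Eventually.of_forall fun s _ => by fun_prop)
  rw [uIoc_of_le zero_le_one] at hs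
  exact norm_cos_mul_rpow_le t hs.1

theorem cosMoment_zero {β : ℝ} (hβ : -1 < β) : cosMoment β 0 = (β + 1)⁻¹ := by
  have : β + 1 ≠ 0 := by linarith
  simp [cosMoment, integral_rpow (Or.inl hβ), Real.zero_rpow this]

/-- Termwise integration of the cosine series. -/
theorem hypOneFTwo_eq_cosMoment {β : ℝ} (hβ : -1 < β) (t : ℝ) :
    hypOneFTwo ((β + 1) / 2) (1 / 2) ((β + 1) / 2 + 1) (-t ^ 2 / 4) = (β + 1) * cosMoment β t := by
  have hβ1 : β + 1 ≠ 0 := by linarith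
  have hsum : HasSum (fun n : ℕ => ∫ s in (0 : ℝ)..1,
      (-1) ^ n * (t * s) ^ (2 * n) / ((2 * n)! : ℝ) * s ^ β) (cosMoment β t) := by
    refine intervalIntegral.hasSum_integral_of_dominated_convergence
      (fun n s => t ^ (2 * n) / ((2 * n)! : ℝ) * s ^ β)
      (fun n => Measurable.aestronglyMeasurable (by fun_prop))
      (fun n => Eventually.of_forall fun s hs => ?_)
      (Eventually.of_forall fun s _ => (Real.hasSum_cosh t).summable.mul_right _) ?_
      (Eventually.of_forall fun s _ => (Real.hasSum_cos (t * s)).mul_right _)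
    · rw [uIoc_of_le zero_le_one] at hs
      have hsβ : 0 ≤ s ^ β := Real.rpow_nonneg hs.1.le β
      rw [norm_mul, norm_div, norm_mul, norm_pow, norm_neg, norm_one, one_pow, one_mul,
        Real.norm_of_nonneg hsβ, Real.norm_natCast, mul_pow, norm_mul, pow_mul t, pow_mul s,
        Real.norm_of_nonneg (show 0 ≤ (t ^ 2) ^ n by positivity),
        Real.norm_of_nonneg (show 0 ≤ (s ^ 2) ^ n by positivity)]
      gcongr
      refine mul_le_of_le_one_right (by positivity) (pow_le_one₀ (by positivity) ?_)
      exact pow_le_one₀ hs.1.le hs.2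
    · simp only [tsum_mul_right]
      exact (intervalIntegral.intervalIntegrable_rpow' hβ).const_mul _
  rw [← hsum.tsum_eq, ← tsum_mul_left, hypOneFTwo]
  refine tsum_congr fun n => ?_
  have hint : ∫ s in (0 : ℝ)..1, (-1) ^ n * (t * s) ^ (2 * n) / ((2 * n)! : ℝ) * s ^ β =
      (-1) ^ n * t ^ (2 * n) / ((2 * n)! : ℝ) * (2 * n + β + 1)⁻¹ := by
    have hexp : -1 < (2 * n : ℝ) + β := by
      have : (0 : ℝ) ≤ n := n.cast_nonneg
      linarith
    have hcongr : ∫ s in (0 : ℝ)..1, (-1) ^ n * (t * s) ^ (2 * n) / ((2 * n)! : ℝ) * s ^ β =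
        ∫ s in (0 : ℝ)..1, (-1) ^ n * t ^ (2 * n) / ((2 * n)! : ℝ) * s ^ ((2 * n : ℝ) + β) := by
      refine intervalIntegral.integral_congr_ae (Eventually.of_forall fun s hs => ?_)
      rw [uIoc_of_le zero_le_one] at hs
      rw [Real.rpow_add hs.1, mul_pow, show (2 * n : ℝ) = ((2 * n : ℕ) : ℝ) by push_cast; rfl,
        Real.rpow_natCast]
      ring
    rw [hcongr, intervalIntegral.integral_const_mul, integral_rpow (Or.inl hexp), Real.one_rpow,
      Real.zero_rpow (by linarith), sub_zero, one_div]
  rw [hint, hypOneFTwo_term_eq (by linarith) t n]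
  have h2 : (2 * n : ℝ) + β + 1 ≠ 0 := by
    have : (0 : ℝ) ≤ n := n.cast_nonneg
    linarith
  rw [show (β + 1) / 2 + (n : ℝ) = (2 * n + β + 1) / 2 by ring]
  field_simp

theorem intervalIntegrable_one_sub_cos_mul_rpow {β : ℝ} (hβ : -1 < β) (z : ℝ) :
    IntervalIntegrable (fun s : ℝ => (1 - Real.cos (s * z)) * s ^ (β - 2)) volume 0 1 := by
  refine IntervalIntegrable.mono_fun'
    ((intervalIntegral.intervalIntegrable_rpow' hβ).const_mul (z ^ 2 / 2))
    (Measurable.aestronglyMeasurable (by fun_prop)) ?_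
  filter_upwards [ae_restrict_mem measurableSet_uIoc] with s hs
  rw [uIoc_of_le zero_le_one] at hs
  have hs0 : 0 < s := hs.1
  rw [Real.norm_of_nonneg (mul_nonneg (sub_nonneg.2 (Real.cos_le_one _)) (by positivity))]
  calc (1 - Real.cos (s * z)) * s ^ (β - 2) ≤ ((s * z) ^ 2 / 2) * s ^ (β - 2) := by
        gcongr
        linarith [Real.one_sub_sq_div_two_le_cos (x := s * z)]
    _ = z ^ 2 / 2 * (s ^ (β - 2) * s ^ 2) := by ring
    _ = z ^ 2 / 2 * s ^ β := by
        rw [← Real.rpow_two s, ← Real.rpow_add hs0, sub_add_cancel]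

/-! ### Identification of the spectral density -/

/-- Two integrations by parts. -/
theorem mul_integral_one_sub_cos_mul_rpow {β : ℝ} (hβ : -1 < β) {z : ℝ} (hz : 0 < z) :
    β * (β - 1) * ∫ s in (0 : ℝ)..1, (1 - Real.cos (s * z)) * s ^ (β - 2) =
      β * (1 - Real.cos z) - z * Real.sin z + z ^ 2 * cosMoment β z := by
  set G : ℝ → ℝ := fun s =>
    β * ((1 - Real.cos (s * z)) * s ^ (β - 1)) - z * (Real.sin (s * z) * s ^ β) with hG
  have hi1 := (intervalIntegrable_one_sub_cos_mul_rpow hβ z).const_mul (β * (β - 1))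
  have hi2 := (intervalIntegrable_cos_mul_rpow hβ z).const_mul (z ^ 2)
  have hd : ∀ s ∈ Ioi (0 : ℝ), HasDerivAt G
      (β * (β - 1) * ((1 - Real.cos (s * z)) * s ^ (β - 2)) -
        z ^ 2 * (Real.cos (z * s) * s ^ β)) s := fun s hs => by
    have hs0 : 0 < s := hs
    have hlin : HasDerivAt (fun s : ℝ => s * z) (1 * z) s := (hasDerivAt_id s).mul_const z
    refine ((((hlin.cos.const_sub 1).mul
      (Real.hasDerivAt_rpow_const (Or.inl hs0.ne'))).const_mul β).sub
      ((hlin.sin.mul (Real.hasDerivAt_rpow_const (Or.inl hs0.ne'))).const_mul z)).congr_deriv ?_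
    rw [show β - 1 - 1 = β - 2 by ring, mul_comm z s]
    ring
  -- `s ^ (β - 1)` may blow up at the origin, but `1 - cos (s z)` is of second order there
  have h0 : Tendsto G (𝓝[>] 0) (𝓝 0) := by
    have hb : Tendsto (fun s : ℝ => (|β| * (z ^ 2 / 2) + z ^ 2) * s ^ (β + 1)) (𝓝[>] 0) (𝓝 0) := by
      have hc : ContinuousAt (fun s : ℝ => s ^ (β + 1)) 0 :=
        Real.continuousAt_rpow_const _ _ (Or.inr (by linarith))
      have := (hc.tendsto.mono_left (nhdsWithin_le_nhds (s := Ioi 0))).const_mul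
        (|β| * (z ^ 2 / 2) + z ^ 2)
      rwa [Real.zero_rpow (by linarith), mul_zero] at this
    refine squeeze_zero_norm' ?_ hb
    filter_upwards [self_mem_nhdsWithin] with s hs
    have hs0 : 0 < s := hs
    have e1 : s ^ (β + 1) = s ^ 2 * s ^ (β - 1) := by
      rw [← Real.rpow_two, ← Real.rpow_add hs0]
      ring_nf
    have e2 : s ^ (β + 1) = s * s ^ β := by rw [Real.rpow_add_one hs0.ne', mul_comm]
    have hsin : |Real.sin (s * z)| ≤ s * z := by
      simpa [abs_of_pos hs0, abs_of_pos hz] using Real.abs_sin_le_abs (x := s * z)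
    rw [hG, add_mul]
    refine (norm_sub_le _ _).trans (add_le_add ?_ ?_)
    · rw [norm_mul, norm_mul, Real.norm_of_nonneg (sub_nonneg.2 (Real.cos_le_one _)),
        Real.norm_of_nonneg (Real.rpow_nonneg hs0.le _), e1, Real.norm_eq_abs]
      calc |β| * ((1 - Real.cos (s * z)) * s ^ (β - 1))
          ≤ |β| * (((s * z) ^ 2 / 2) * s ^ (β - 1)) := by
            gcongr
            linarith [Real.one_sub_sq_div_two_le_cos (x := s * z)]
        _ = _ := by ring
    · rw [norm_mul, norm_mul, Real.norm_of_nonneg hz.le,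
        Real.norm_of_nonneg (Real.rpow_nonneg hs0.le _), e2, Real.norm_eq_abs]
      calc z * (|Real.sin (s * z)| * s ^ β) ≤ z * ((s * z) * s ^ β) := by gcongr
        _ = _ := by ring
  have h1 : Tendsto G (𝓝[<] 1) (𝓝 (G 1)) :=
    (hd 1 (mem_Ioi.2 one_pos)).continuousAt.tendsto.mono_left nhdsWithin_le_nhds
  have key := intervalIntegral.integral_eq_sub_of_hasDerivAt_of_tendsto one_pos
    (fun s hs => hd s hs.1) (hi1.sub hi2) h0 h1
  rw [intervalIntegral.integral_sub hi1 hi2, intervalIntegral.integral_const_mul,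
    intervalIntegral.integral_const_mul] at key
  simp only [hG, one_mul, Real.one_rpow, mul_one, sub_zero] at key
  rw [cosMoment]
  linarith

/-- The constant of the singular term `t ^ (α - 1)`, by the reflection formula at `α`. -/
theorem mul_pi_div_Gamma_mul_cos {α : ℝ} (hα : 0 < α) (hα1 : α < 1) :
    α * (1 + α) * (Real.pi / (2 * Real.Gamma (α + 2) * Real.cos (Real.pi * α / 2))) =
      Real.sin (Real.pi * α / 2) * Real.Gamma (1 - α) := by
  have hπ := Real.pi_pos
  have hrefl := Real.Gamma_mul_Gamma_one_sub α
  have hcos : Real.cos (Real.pi * α / 2) ≠ 0 :=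
    (Real.cos_pos_of_mem_Ioo ⟨by nlinarith, by nlinarith⟩).ne'
  have hsin : Real.sin (Real.pi * α / 2) ≠ 0 :=
    (Real.sin_pos_of_pos_of_lt_pi (by positivity) (by nlinarith)).ne'
  have hΓ : Real.Gamma α ≠ 0 := (Real.Gamma_pos_of_pos hα).ne'
  rw [show Real.pi * α = 2 * (Real.pi * α / 2) by ring, Real.sin_two_mul,
    eq_div_iff (by simp [hcos, hsin])] at hrefl
  rw [show α + 2 = α + 1 + 1 by ring, Real.Gamma_add_one (by linarith),
    Real.Gamma_add_one hα.ne']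
  have : α + 1 ≠ 0 := by linarith
  generalize Real.sin (Real.pi * α / 2) = S at *
  generalize Real.cos (Real.pi * α / 2) = C at *
  field_simp
  linear_combination (-(1 + α)) * hrefl

theorem lgdSpectralDensity_eq_cosMoment {α θ : ℝ} (hα1 : α < 1) (hθ : 0 < θ) (t : ℝ) :
    lgdSpectralDensity α θ t = 1 / Real.pi * (Real.sin t / t +
      θ / (θ + α) * (t ^ (α - 1) * Real.sin (Real.pi * α / 2) * Real.Gamma (1 - α) -
        cosMoment (-α) t) - α / (θ + α) * cosMoment θ t) := by
  have h1 := hypOneFTwo_eq_cosMoment (β := -α) (by linarith) t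
  have h2 := hypOneFTwo_eq_cosMoment (β := θ) (by linarith) t
  rw [show (-α + 1) / 2 = 1 / 2 - α / 2 by ring, show 1 / 2 - α / 2 + 1 = 3 / 2 - α / 2 by ring]
    at h1
  rw [show (θ + 1) / 2 = θ / 2 + 1 / 2 by ring, show θ / 2 + 1 / 2 + 1 = θ / 2 + 3 / 2 by ring]
    at h2
  rw [lgdSpectralDensity, h1, h2]
  have e1 : (α - 1)⁻¹ * ((-α + 1) * cosMoment (-α) t) = -cosMoment (-α) t := by
    rw [show -α + 1 = -(α - 1) by ring, neg_mul, mul_neg, inv_mul_cancel_left₀ (by linarith)]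
  have e2 : α / ((θ + 1) * (θ + α)) * ((θ + 1) * cosMoment θ t) =
      α / (θ + α) * cosMoment θ t := by
    rw [← mul_assoc, div_mul_eq_mul_div, mul_comm α, mul_div_mul_left _ _ (by positivity)]
  rw [e1, e2]
  ring

/-- The hypergeometric expression is the density of a mixture of triangle functions. -/
theorem lgdSpectralDensity_eq_polyaDensity {α θ : ℝ} (hα : 0 < α) (hα1 : α < 1) (hθ : 0 < θ)
    (hθ1 : θ ≤ 1) {z : ℝ} (hz : 0 < z) :
    lgdSpectralDensity α θ z = polyaDensity (lgdCurvature α θ) z := by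
  have hK : θ + α ≠ 0 := by positivity
  set A : ℝ := ∫ s in (0 : ℝ)..1, (1 - Real.cos (s * z)) * s ^ (θ - 2) with hA
  set D : ℝ := ∫ s in (0 : ℝ)..1, (1 - Real.cos (s * z)) * s ^ (-α - 2) with hD
  set K : ℝ := α * θ / (θ + α) with hKdef
  have hAeq := mul_integral_one_sub_cos_mul_rpow (β := θ) (by linarith) hz
  have hDeq := mul_integral_one_sub_cos_mul_rpow (β := -α) (by linarith) hz
  rw [← hA] at hAeq
  rw [← hD] at hDeq
  obtain ⟨hMi, hM⟩ :=
    integral_one_sub_cos_mul_mul_rpow (p := α + 2) (by linarith) (by linarith) hz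
  simp only [mul_comm z, neg_add'] at hMi hM
  have hcurv := integrableOn_one_sub_cos_mul (measurable_lgdCurvature α θ)
    (fun s hs => lgdCurvature_nonneg hα hθ hθ1 hs) (integral_mul_lgdCurvature hα hθ hθ1).1 hz.le
  have hsplit : ∀ g : ℝ → ℝ, IntegrableOn g (Ioi 0) →
      ∫ s in Ioi (0 : ℝ), g s = (∫ s in (0 : ℝ)..1, g s) + ∫ s in Ioi (1 : ℝ), g s := fun g hg => by
    rw [intervalIntegral.integral_of_le zero_le_one, ← setIntegral_union (Ioc_disjoint_Ioi le_rfl)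
      measurableSet_Ioi (hg.mono_set Ioc_subset_Ioi_self) (hg.mono_set (Ioi_subset_Ioi zero_le_one)),
      Ioc_union_Ioi_eq_Ioi zero_le_one]
  have hnear : ∫ s in (0 : ℝ)..1, (1 - Real.cos (s * z)) * lgdCurvature α θ s =
      K * (1 - θ) * A := by
    rw [hA, ← intervalIntegral.integral_const_mul]
    refine intervalIntegral.integral_congr_ae (Eventually.of_forall fun s hs => ?_)
    rw [uIoc_of_le zero_le_one] at hs
    rw [lgdCurvature, if_pos hs.2]
    ring
  have hfar : ∫ s in Ioi (1 : ℝ), (1 - Real.cos (s * z)) * lgdCurvature α θ s =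
      K * (1 + α) * ∫ s in Ioi (1 : ℝ), (1 - Real.cos (s * z)) * s ^ (-α - 2) := by
    rw [← integral_const_mul]
    refine setIntegral_congr_fun measurableSet_Ioi fun s hs => ?_
    rw [lgdCurvature, if_neg (not_le.2 hs)]
    ring
  have hM1 := hsplit _ hMi
  rw [hM, ← hD, show α + 2 - 1 = (α - 1) + 2 by ring, Real.rpow_add hz, Real.rpow_two,
    show α + 2 - 2 = α by ring] at hM1
  rw [lgdSpectralDensity_eq_cosMoment hα1 hθ, polyaDensity, hsplit _ hcurv, hnear, hfar,
    ← sub_eq_of_eq_add' hM1, hKdef]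
  have hconst := mul_pi_div_Gamma_mul_cos hα hα1
  set Q := Real.pi / (2 * Real.Gamma (α + 2) * Real.cos (Real.pi * α / 2))
  rw [mul_assoc (z ^ (α - 1)), ← hconst]
  have hπ := Real.pi_ne_zero
  field_simp
  linear_combination α * hAeq + θ * hDeq

/-! ### Spectral measures on the line -/

theorem factorial_mul_Gamma_add_half (k : ℕ) :
    (k ! : ℝ) * Real.Gamma (k + 1 / 2) * 4 ^ k = ((2 * k)! : ℝ) * √Real.pi := by
  induction k with
  | zero => simp only [CharP.cast_eq_zero, zero_add, Real.Gamma_one_half_eq]; simp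
  | succ k ih =>
    have hk : (k : ℝ) + 1 / 2 ≠ 0 := by positivity
    rw [show 2 * (k + 1) = 2 * k + 1 + 1 by ring, Nat.factorial_succ (2 * k + 1),
      Nat.factorial_succ (2 * k), Nat.factorial_succ k]
    push_cast
    rw [show (k : ℝ) + 1 + 1 / 2 = k + 1 / 2 + 1 by ring, Real.Gamma_add_one hk]
    linear_combination ((2 * k + 1 + 1) * (2 * k + 1) : ℝ) * ih

/-- The kernel of the spectral representation on the line is the cosine, since
`J_{-1/2}(z) = √(2 / (π z)) cos z`. -/
theorem sphericalY_one {z : ℝ} (hz : 0 ≤ z) : sphericalY 1 z = Real.cos z := by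
  rcases hz.eq_or_lt with rfl | hz
  · simp [sphericalY]
  have h2 : (0 : ℝ) < z / 2 := by positivity
  have hterm : ∀ k : ℕ, (-1) ^ k / ((k ! : ℝ) * Real.Gamma (k + (((1 : ℕ) : ℝ) - 2) / 2 + 1)) *
      (z / 2) ^ (2 * (k : ℝ) + (((1 : ℕ) : ℝ) - 2) / 2) =
        (√Real.pi)⁻¹ * (z / 2) ^ (-(1 / 2) : ℝ) *
          ((-1) ^ k * z ^ (2 * k) / ((2 * k)! : ℝ)) := fun k => by
    have hG := factorial_mul_Gamma_add_half k
    have hpos : 0 < Real.Gamma (k + 1 / 2) := Real.Gamma_pos_of_pos (by positivity)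
    have hπ : √Real.pi ≠ 0 := (Real.sqrt_pos.2 Real.pi_pos).ne'
    have hf : ((2 * k)! : ℝ) ≠ 0 := by positivity
    rw [Nat.cast_one, show (k : ℝ) + (1 - 2) / 2 + 1 = k + 1 / 2 by ring,
      show 2 * (k : ℝ) + (1 - 2) / 2 = -(1 / 2) + ((2 * k : ℕ) : ℝ) by push_cast; ring,
      Real.rpow_add h2, Real.rpow_natCast, div_pow, pow_mul (2 : ℝ)]
    norm_num only
    rw [(eq_div_iff hπ).2 hG.symm]
    field_simp
  have hne : z / 2 ≠ 0 := h2.ne'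
  rw [sphericalY, if_neg hz.ne', besselJ, tsum_congr hterm, tsum_mul_left, ← Real.cos_eq_tsum,
    Nat.cast_one, Real.Gamma_one_half_eq, show ((1 : ℝ) - 2) / 2 = -(1 / 2) by ring,
    Real.div_rpow hz.le (by norm_num), show ((2 : ℝ) - 1) / 2 = 1 / 2 by ring,
    Real.rpow_neg hz.le]
  have h3 : (0 : ℝ) < 2 ^ (-(1 / 2) : ℝ) := by positivity
  have h4 : 0 < z ^ (1 / 2 : ℝ) := by positivity
  have h5 : 0 < √Real.pi := Real.sqrt_pos.2 Real.pi_pos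
  field_simp

theorem IsIsotropicSpectralMeasure.integral_cos {B : ℝ → ℝ} {Φ : Measure ℝ}
    (h : IsIsotropicSpectralMeasure 1 B Φ) {r : ℝ} (hr : 0 ≤ r) :
    ∫ z, Real.cos (r * z) ∂Φ = B r := by
  rw [h.repr r hr]
  refine integral_congr_ae ?_
  have hnn : ∀ᵐ z ∂Φ, z ∉ Iio (0 : ℝ) := measure_eq_zero_iff_ae_notMem.1 h.null_neg
  filter_upwards [hnn] with z hz
  rw [sphericalY_one (mul_nonneg hr (not_lt.1 hz))]

/-- The even measure `Φ + Φ ∘ (-1)` has a characteristic function determined by `B`. -/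
theorem IsIsotropicSpectralMeasure.charFun_symm {B : ℝ → ℝ} {Φ : Measure ℝ}
    (h : IsIsotropicSpectralMeasure 1 B Φ) (t : ℝ) :
    charFun (Φ + Φ.map (fun x => -x)) t = ((2 * B |t| : ℝ) : ℂ) := by
  have := h.finite
  have hb : ∀ s : ℝ, Integrable (fun x : ℝ => Complex.exp (s * x * Complex.I)) Φ := fun s => by
    refine Integrable.of_bound (C := 1) (Measurable.aestronglyMeasurable (by fun_prop))
      (Eventually.of_forall fun x => ?_)
    rw [← Complex.ofReal_mul, Complex.norm_exp_ofReal_mul_I]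
  have hb' : Integrable (fun x : ℝ => Complex.exp (t * x * Complex.I))
      (Φ.map (fun x => -x)) := by
    refine Integrable.of_bound (C := 1) (Measurable.aestronglyMeasurable (by fun_prop))
      (Eventually.of_forall fun x => ?_)
    rw [← Complex.ofReal_mul, Complex.norm_exp_ofReal_mul_I]
  have hneg : ∫ x : ℝ, Complex.exp (t * x * Complex.I) ∂(Φ.map (fun x => -x)) =
      ∫ x : ℝ, Complex.exp ((-t : ℝ) * x * Complex.I) ∂Φ := by
    rw [integral_map (by fun_prop) (Measurable.aestronglyMeasurable (by fun_prop))]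
    simp
  rw [charFun_apply_real, integral_add_measure (hb t) hb', hneg, ← integral_add (hb t) (hb (-t)),
    ← h.integral_cos (abs_nonneg t), ← integral_const_mul, ← integral_complex_ofReal]
  refine integral_congr_ae (Eventually.of_forall fun x => ?_)
  have habs : Real.cos (|t| * x) = Real.cos (t * x) := by
    rcases abs_choice t with h | h <;> simp [h]
  simp only [habs]
  push_cast
  rw [Complex.two_cos]
  simp

/-- On the line the covariance function determines the distribution function of the isotropic
spectral measure. -/
theorem IsIsotropicSpectralMeasure.real_Iic_eq {B : ℝ → ℝ} {Φ Ψ : Measure ℝ}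
    (hΦ : IsIsotropicSpectralMeasure 1 B Φ) (hΨ : IsIsotropicSpectralMeasure 1 B Ψ) {z : ℝ}
    (hz : 0 ≤ z) : Φ.real (Iic z) = Ψ.real (Iic z) := by
  have := hΦ.finite
  have := hΨ.finite
  have hsymm : Φ + Φ.map (fun x => -x) = Ψ + Ψ.map (fun x => -x) :=
    Measure.ext_of_charFun (funext fun t => by rw [hΦ.charFun_symm, hΨ.charFun_symm])
  have htail : ∀ {Θ : Measure ℝ}, Θ (Iio 0) = 0 →
      (Θ + Θ.map (fun x => -x)) (Ioi z) = Θ (Ioi z) := fun {Θ} h0 => by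
    rw [Measure.add_apply, Measure.map_apply measurable_neg measurableSet_Ioi]
    have : (fun x : ℝ => -x) ⁻¹' Ioi z ⊆ Iio 0 := fun x hx => by
      have : z < -x := hx
      simp only [mem_Iio]
      linarith
    rw [measure_mono_null this h0, add_zero]
  have hIoi : Φ.real (Ioi z) = Ψ.real (Ioi z) := by
    rw [measureReal_def, measureReal_def, ← htail hΦ.null_neg, ← htail hΨ.null_neg, hsymm]
  have huniv : ∀ {Θ : Measure ℝ}, IsIsotropicSpectralMeasure 1 B Θ → Θ.real univ = B 0 :=
    fun {Θ} h => by simpa using h.integral_cos le_rfl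
  rw [← compl_Ioi, measureReal_compl measurableSet_Ioi, measureReal_compl measurableSet_Ioi,
    huniv hΦ, huniv hΨ, hIoi]

theorem ae_eq_of_forall_integral_eq {f g : ℝ → ℝ} (hf : IntegrableOn f (Ioi 0))
    (hg : IntegrableOn g (Ioi 0))
    (h : ∀ z : ℝ, 0 ≤ z → ∫ u in (0 : ℝ)..z, f u = ∫ u in (0 : ℝ)..z, g u) :
    f =ᵐ[volume.restrict (Ioi 0)] g := by
  have hint : ∀ {k : ℝ → ℝ}, IntegrableOn k (Ioi 0) → ∀ z : ℝ, 0 ≤ z →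
      IntervalIntegrable k volume 0 z := fun hk z hz =>
    (intervalIntegrable_iff_integrableOn_Ioc_of_le hz).2 (hk.mono_set Ioc_subset_Ioi_self)
  have hloc : LocallyIntegrable ((Ioi (0 : ℝ)).indicator (f - g)) volume :=
    ((hf.sub hg).integrable_indicator measurableSet_Ioi).locallyIntegrable
  have hzero : ∀ z : ℝ, 0 ≤ z → ∫ u in (0 : ℝ)..z, (Ioi (0 : ℝ)).indicator (f - g) u = 0 :=
    fun z hz => by
      have : ∫ u in (0 : ℝ)..z, (Ioi (0 : ℝ)).indicator (f - g) u =
          ∫ u in (0 : ℝ)..z, (f u - g u) := by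
        refine intervalIntegral.integral_congr_ae (Eventually.of_forall fun u hu => ?_)
        rw [uIoc_of_le hz] at hu
        rw [indicator_of_mem (mem_Ioi.2 hu.1), Pi.sub_apply]
      rw [this, intervalIntegral.integral_sub (hint hf z hz) (hint hg z hz), h z hz, sub_self]
  rw [EventuallyEq, ae_restrict_iff' measurableSet_Ioi]
  filter_upwards [LocallyIntegrable.ae_hasDerivAt_integral hloc] with x hx hx0
  have hd := hx 0
  have hconst : (fun z : ℝ => ∫ u in (0 : ℝ)..z, (Ioi (0 : ℝ)).indicator (f - g) u) =ᶠ[𝓝 x]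
      fun _ => 0 := by
    filter_upwards [Ioi_mem_nhds hx0] with z hz using hzero z (le_of_lt hz)
  have := hd.unique ((hasDerivAt_const x (0 : ℝ)).congr_of_eventuallyEq hconst)
  rw [indicator_of_mem hx0, Pi.sub_apply] at this
  exact sub_eq_zero.1 this

theorem IsIsotropicSpectralDensity.integrableOn {B f : ℝ → ℝ}
    (h : IsIsotropicSpectralDensity 1 B f) : IntegrableOn f (Ioi 0) := by
  simpa using h.integrable

/-- The surface area `2 π ^ (d / 2) / Γ (d / 2)` of the unit sphere, for `d = 1`. -/
theorem spectralMass_const_one :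
    2 * Real.pi ^ (((1 : ℕ) : ℝ) / 2) * (Real.Gamma (((1 : ℕ) : ℝ) / 2))⁻¹ = 2 := by
  rw [Nat.cast_one, Real.Gamma_one_half_eq, ← Real.sqrt_eq_rpow,
    mul_inv_cancel_right₀ (Real.sqrt_pos.2 Real.pi_pos).ne']

theorem IsIsotropicSpectralDensity.ae_eq {B f g : ℝ → ℝ}
    (hf : IsIsotropicSpectralDensity 1 B f) (hg : IsIsotropicSpectralDensity 1 B g) :
    f =ᵐ[volume.restrict (Ioi 0)] g := by
  obtain ⟨Φ, hΦ, hΦf⟩ := hf.distrib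
  obtain ⟨Ψ, hΨ, hΨg⟩ := hg.distrib
  refine ae_eq_of_forall_integral_eq hf.integrableOn hg.integrableOn fun z hz => ?_
  have h1 := hΦf z hz
  rw [hΦ.real_Iic_eq hΨ hz, hΨg z hz, spectralMass_const_one] at h1
  simp only [Nat.cast_one, sub_self, Real.rpow_zero, one_mul] at h1
  linarith

/-- A nonnegative integrable function whose cosine transform is `B / 2` is a spectral density. -/
theorem isIsotropicSpectralDensity_of_integral_cos {B f : ℝ → ℝ} (hfi : IntegrableOn f (Ioi 0))
    (h0 : ∀ z, 0 < z → 0 ≤ f z)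
    (hB : ∀ r, 0 ≤ r → ∫ z in Ioi (0 : ℝ), Real.cos (r * z) * f z = 1 / 2 * B r) :
    IsIsotropicSpectralDensity 1 B f := by
  refine ⟨by simpa using hfi, (volume.restrict (Ioi 0)).withDensity
    (fun z => ENNReal.ofReal (2 * f z)), ⟨?_, ?_, fun r hr => ?_⟩, fun z hz => ?_⟩
  · exact isFiniteMeasure_withDensity_ofReal (hfi.const_mul 2).2
  · have hempty : Iio (0 : ℝ) ∩ Ioi 0 = ∅ := disjoint_iff_inter_eq_empty.1
      (disjoint_left.2 fun x hx hx' => lt_asymm (mem_Iio.1 hx) (mem_Ioi.1 hx'))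
    rw [withDensity_apply _ measurableSet_Iio, Measure.restrict_restrict measurableSet_Iio, hempty,
      Measure.restrict_empty, lintegral_zero_measure]
  · rw [integral_withDensity_eq_integral_toReal_smul₀
      (hfi.aemeasurable.const_mul 2).ennreal_ofReal
      (Eventually.of_forall fun _ => ENNReal.ofReal_lt_top)]
    have hcongr : ∀ z ∈ Ioi (0 : ℝ), (ENNReal.ofReal (2 * f z)).toReal • sphericalY 1 (r * z) =
        2 * (Real.cos (r * z) * f z) := fun z hz => by
      have hz' : 0 < z := hz
      rw [ENNReal.toReal_ofReal (mul_nonneg zero_le_two (h0 z hz)),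
        sphericalY_one (by positivity), smul_eq_mul]
      ring
    rw [setIntegral_congr_fun measurableSet_Ioi hcongr, integral_const_mul, hB r hr]
    ring
  · have hset : Iic z ∩ Ioi 0 = Ioc 0 z := by
      ext x
      simp [and_comm]
    rw [spectralMass_const_one, measureReal_def, withDensity_apply _ measurableSet_Iic,
      Measure.restrict_restrict measurableSet_Iic, hset, ← integral_toReal
        ((hfi.mono_set Ioc_subset_Ioi_self).aemeasurable.const_mul 2).ennreal_ofReal
        (Eventually.of_forall fun _ => ENNReal.ofReal_lt_top),
      intervalIntegral.integral_of_le hz, ← integral_const_mul]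
    refine setIntegral_congr_fun measurableSet_Ioc fun u hu => ?_
    simp only [Nat.cast_one, sub_self, Real.rpow_zero, one_mul]
    exact ENNReal.toReal_ofReal (mul_nonneg zero_le_two (h0 u hu.1))

theorem isIsotropicSpectralDensity_lgd {α θ : ℝ} (hα : 0 < α) (hα1 : α < 1) (hθ : 0 < θ)
    (hθ1 : θ ≤ 1) :
    IsIsotropicSpectralDensity 1 (lgdCovariance α θ) (lgdSpectralDensity α θ) := by
  have heq : ∀ z ∈ Ioi (0 : ℝ),
      polyaDensity (lgdCurvature α θ) z = lgdSpectralDensity α θ z := fun z hz =>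
    (lgdSpectralDensity_eq_polyaDensity hα hα1 hθ hθ1 hz).symm
  have hnn : ∀ s, 0 < s → 0 ≤ lgdCurvature α θ s := fun s hs => lgdCurvature_nonneg hα hθ hθ1 hs
  obtain ⟨hi, hcos⟩ := integrableOn_polyaDensity_and_integral_cos_mul
    (measurable_lgdCurvature α θ) hnn (integral_mul_lgdCurvature hα hθ hθ1).1
  refine isIsotropicSpectralDensity_of_integral_cos
    (IntegrableOn.congr_fun hi heq measurableSet_Ioi) (fun z hz => ?_) fun r hr => ?_
  · rw [← heq z hz]
    exact polyaDensity_nonneg hnn z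
  · rw [← (integral_max_sub_mul_lgdCurvature hα hθ hθ1 hr).2, ← hcos r hr]
    refine setIntegral_congr_fun measurableSet_Ioi fun z hz => ?_
    simp only [heq z hz]

/-! ### Slow variation -/

theorem lgdCovariance_le_one {α θ r : ℝ} (hα : 0 < α) (hθ : 0 < θ) (hr : 0 ≤ r) :
    lgdCovariance α θ r ≤ 1 := by
  unfold lgdCovariance
  split_ifs with h
  · have : 0 ≤ α / (θ + α) * r ^ θ := by positivity
    linarith
  · exact mul_le_one₀ ((div_le_one (by positivity)).2 (by linarith)) (by positivity)
      (Real.rpow_le_one_of_one_le_of_nonpos (le_of_lt (not_le.1 h)) (by linarith))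

theorem le_lgdCovariance {α θ r : ℝ} (hα : 0 < α) (hθ : 0 < θ) (hr : 0 ≤ r) (hr1 : r ≤ 1) :
    θ / (θ + α) ≤ lgdCovariance α θ r := by
  have h1 : r ^ θ ≤ 1 := Real.rpow_le_one hr hr1 hθ.le
  have h2 : θ / (θ + α) = 1 - α / (θ + α) := by field_simp; ring
  rw [lgdCovariance, if_pos hr1, h2]
  exact sub_le_sub_left (mul_le_of_le_one_right (by positivity) h1) 1

theorem lgdCovariance_pos {α θ r : ℝ} (hα : 0 < α) (hθ : 0 < θ) (hr : 0 ≤ r) :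
    0 < lgdCovariance α θ r := by
  rcases le_or_gt r 1 with h | h
  · exact (show 0 < θ / (θ + α) by positivity).trans_le (le_lgdCovariance hα hθ hr h)
  · rw [lgdCovariance, if_neg (not_le.2 h)]
    have : 0 < r := by linarith
    positivity

theorem lgdSlow_of_one_lt (α θ : ℝ) {t : ℝ} (ht : 1 < t) : lgdSlow α θ t = θ / (θ + α) := by
  have h0 : 0 < t := by linarith
  rw [lgdSlow, lgdCovariance, if_neg (not_le.2 ht), mul_left_comm, ← Real.rpow_add h0,
    add_neg_cancel, Real.rpow_zero, mul_one]

theorem lgdSlow_pos {α θ t : ℝ} (hα : 0 < α) (hθ : 0 < θ) (ht : 0 < t) : 0 < lgdSlow α θ t :=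
  mul_pos (Real.rpow_pos_of_pos ht α) (lgdCovariance_pos hα hθ ht.le)

theorem isSlowlyVarying_lgdSlow {α θ : ℝ} (hα : 0 < α) (hθ : 0 < θ) :
    IsSlowlyVarying (lgdSlow α θ) := by
  refine ⟨?_, fun t ht => lgdSlow_pos hα hθ ht, fun t ht => ?_⟩
  · have hB : Measurable (lgdCovariance α θ) :=
      Measurable.ite measurableSet_Iic (by fun_prop) (by fun_prop)
    have hL : Measurable (lgdSlow α θ) := (by fun_prop : Measurable fun t : ℝ => t ^ α).mul hB
    exact hL.comp measurable_subtype_coe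
  · refine tendsto_const_nhds.congr' ?_
    filter_upwards [eventually_gt_atTop 1, eventually_gt_atTop (1 / t)] with s hs hst
    rw [lgdSlow_of_one_lt α θ hs, lgdSlow_of_one_lt α θ ((div_lt_iff₀ ht).1 hst),
      div_self (show θ / (θ + α) ≠ 0 by positivity)]

theorem hasSlowVariationRemainder_lgdSlow {α θ : ℝ} (hα : 0 < α) (hθ : 0 < θ) (q ν : ℝ) :
    HasSlowVariationRemainder (lgdSlow α θ) q ν := by
  -- `L` is constant on `(1, ∞)`, so that the left-hand side vanishes for `r > 1`
  refine ⟨0, ?_⟩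
  filter_upwards [eventually_gt_atTop 1] with r hr t ht
  have htr : 1 < t * r := one_lt_mul_of_le_of_lt ht hr
  rw [lgdSlow_of_one_lt α θ hr, lgdSlow_of_one_lt α θ htr,
    div_self (show θ / (θ + α) ≠ 0 by positivity)]
  simp

theorem isLocallyBoundedOnPos_lgdSlow {α θ : ℝ} (hα : 0 < α) (hθ : 0 < θ) :
    IsLocallyBoundedOnPos (lgdSlow α θ) := by
  refine fun a b ha => ⟨b ^ α, fun t ht => ?_⟩
  have h0 : 0 < t := ha.trans_le ht.1
  rw [abs_of_pos (lgdSlow_pos hα hθ h0)]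
  calc lgdSlow α θ t ≤ t ^ α :=
        mul_le_of_le_one_right (by positivity) (lgdCovariance_le_one hα hθ h0.le)
    _ ≤ b ^ α := Real.rpow_le_rpow h0.le ht.2 hα.le

/-! ### Asymptotics of the spectral density -/

/-- Legendre's duplication formula at `(1 - α) / 2` and the reflection formula at `α / 2`. -/
theorem cTwo_one {α : ℝ} (hα : 0 < α) (hα1 : α < 1) :
    cTwo 1 α = Real.Gamma (1 - α) * Real.sin (Real.pi * α / 2) / Real.pi := by
  have hπ := Real.pi_pos
  have hdup := Real.Gamma_mul_Gamma_add_half ((1 - α) / 2)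
  have hrefl := Real.Gamma_mul_Gamma_one_sub (α / 2)
  rw [show (1 - α) / 2 + 1 / 2 = 1 - α / 2 by ring, show 2 * ((1 - α) / 2) = 1 - α by ring,
    show 1 - (1 - α) = α by ring] at hdup
  have hsin : 0 < Real.sin (Real.pi * α / 2) :=
    Real.sin_pos_of_pos_of_lt_pi (by positivity) (by nlinarith)
  rw [show Real.pi * (α / 2) = Real.pi * α / 2 by ring, eq_div_iff hsin.ne'] at hrefl
  have h1 : 0 < Real.Gamma (α / 2) := Real.Gamma_pos_of_pos (by linarith)
  have h2 : 0 < Real.Gamma (1 - α / 2) := Real.Gamma_pos_of_pos (by linarith)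
  have h3 : 0 < √Real.pi := Real.sqrt_pos.2 hπ
  have h4 : (0 : ℝ) < 2 ^ α := by positivity
  rw [cTwo, Nat.cast_one, ← Real.sqrt_eq_rpow, div_eq_div_iff (by positivity) hπ.ne']
  linear_combination (Real.Gamma (α / 2) * Real.sin (Real.pi * α / 2)) * hdup -
    Real.Gamma ((1 - α) / 2) * hrefl

theorem tendsto_lgdSpectralDensity_sub {α θ : ℝ} (hα : 0 < α) (hα1 : α < 1) (hθ : 0 < θ) :
    Tendsto (fun t : ℝ => lgdSpectralDensity α θ t -
        θ * Real.Gamma (1 - α) * Real.sin (Real.pi * α / 2) / (Real.pi * (θ + α)) * t ^ (α - 1))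
      (𝓝[>] 0) (𝓝 (α * θ / (Real.pi * (1 + θ) * (α - 1)))) := by
  -- without the singular term the density extends continuously to `t = 0`
  have hlim : Tendsto (fun t : ℝ => 1 / Real.pi * (Real.sinc t - θ / (θ + α) * cosMoment (-α) t -
      α / (θ + α) * cosMoment θ t)) (𝓝 0) (𝓝 (1 / Real.pi * (Real.sinc 0 -
        θ / (θ + α) * cosMoment (-α) 0 - α / (θ + α) * cosMoment θ 0))) := by
    have h1 := continuous_cosMoment (β := -α) (by linarith)
    have h2 := continuous_cosMoment (β := θ) (by linarith)
    have h3 := Real.continuous_sinc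
    exact Continuous.tendsto (by fun_prop) 0
  have hval : 1 / Real.pi * (Real.sinc 0 - θ / (θ + α) * cosMoment (-α) 0 -
      α / (θ + α) * cosMoment θ 0) = α * θ / (Real.pi * (1 + θ) * (α - 1)) := by
    rw [Real.sinc_zero, cosMoment_zero (by linarith), cosMoment_zero (by linarith)]
    have h1 : -α + 1 ≠ 0 := by linarith
    have h2 : α - 1 ≠ 0 := by linarith
    have h3 := Real.pi_ne_zero
    field_simp
    ring
  rw [← hval]
  refine (hlim.mono_left nhdsWithin_le_nhds).congr' ?_
  filter_upwards [self_mem_nhdsWithin] with t ht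
  have ht0 : t ≠ 0 := (mem_Ioi.1 ht).ne'
  rw [lgdSpectralDensity_eq_cosMoment hα1 hθ, Real.sinc_of_ne_zero ht0]
  have h3 := Real.pi_ne_zero
  field_simp
  ring

theorem isBigO_lgdSpectralDensity_sub {α θ : ℝ} (hα : 0 < α) (hα1 : α < 1) (hθ : 0 < θ) :
    (fun t : ℝ => lgdSpectralDensity α θ t - cTwo 1 α * (θ / (θ + α)) * t ^ (α - 1))
      =O[𝓝[>] 0] fun _ => (1 : ℝ) := by
  have h := (tendsto_lgdSpectralDensity_sub hα hα1 hθ).isBigO_one ℝ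
  rwa [show θ * Real.Gamma (1 - α) * Real.sin (Real.pi * α / 2) / (Real.pi * (θ + α)) =
    cTwo 1 α * (θ / (θ + α)) by rw [cTwo_one hα hα1, div_mul_div_comm]; ring] at h

theorem cTwo_one_pos {α : ℝ} (hα : 0 < α) (hα1 : α < 1) : 0 < cTwo 1 α := by
  have h1 : 0 < Real.Gamma (α / 2) := Real.Gamma_pos_of_pos (by linarith)
  have h2 : 0 < Real.Gamma ((((1 : ℕ) : ℝ) - α) / 2) :=
    Real.Gamma_pos_of_pos (by rw [Nat.cast_one]; linarith)
  unfold cTwo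
  positivity

theorem exists_lgdSpectralDensity_eq_mul_one_add {α θ : ℝ} (hα : 0 < α) (hα1 : α < 1)
    (hθ : 0 < θ) :
    ∃ ρ : ℝ → ℝ, ρ =O[𝓝[>] 0] (fun t : ℝ => t ^ (1 - α)) ∧
      ∀ t : ℝ, 0 < t →
        lgdSpectralDensity α θ t = cTwo 1 α * (θ / (θ + α)) * t ^ (α - 1) * (1 + ρ t) := by
  have hc := cTwo_one_pos hα hα1
  refine ⟨fun t => (lgdSpectralDensity α θ t - cTwo 1 α * (θ / (θ + α)) * t ^ (α - 1)) *
    (cTwo 1 α * (θ / (θ + α)) * t ^ (α - 1))⁻¹, ?_, fun t ht => ?_⟩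
  · have h2 : (fun t : ℝ => (cTwo 1 α * (θ / (θ + α)) * t ^ (α - 1))⁻¹) =O[𝓝[>] 0]
        fun t : ℝ => t ^ (1 - α) := by
      refine ((isBigO_refl (fun t : ℝ => t ^ (1 - α)) _).const_mul_left
        (cTwo 1 α * (θ / (θ + α)))⁻¹).congr' ?_ EventuallyEq.rfl
      filter_upwards [self_mem_nhdsWithin] with t ht
      rw [mul_inv (cTwo 1 α * (θ / (θ + α))), ← Real.rpow_neg (le_of_lt ht), neg_sub]
    simpa using (isBigO_lgdSpectralDensity_sub hα hα1 hθ).mul h2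
  · have : 0 < t ^ (α - 1) := Real.rpow_pos_of_pos ht _
    field_simp
    ring

theorem isBigO_lgdSpectralDensity_atTop {α θ : ℝ} (hα : 0 < α) (hα1 : α < 1) (hθ : 0 < θ)
    (hθ1 : θ ≤ 1) : lgdSpectralDensity α θ =O[atTop] (fun t : ℝ => 1 / t) := by
  refine IsBigO.of_bound Real.pi⁻¹ ?_
  filter_upwards [eventually_gt_atTop 0] with t ht
  have hnn : ∀ s, 0 < s → 0 ≤ lgdCurvature α θ s := fun s hs => lgdCurvature_nonneg hα hθ hθ1 hs
  obtain ⟨hi, he⟩ := integral_mul_lgdCurvature hα hθ hθ1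
  have hle := polyaDensity_le (measurable_lgdCurvature α θ) hnn hi ht
  rw [he, mul_one, mul_inv] at hle
  rw [lgdSpectralDensity_eq_polyaDensity hα hα1 hθ hθ1 ht,
    Real.norm_of_nonneg (polyaDensity_nonneg hnn t), Real.norm_of_nonneg (by positivity), one_div]
  exact hle

theorem lgdSpectralDensity_expansion {α θ : ℝ} (hα : 0 < α) (hα1 : α < 1) (hθ : 0 < θ)
    (hθ1 : θ ≤ 1) :
    (fun t : ℝ => lgdSpectralDensity α θ t - cTwo 1 α * t ^ (α - 1) * lgdSlow α θ (1 / t))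
      =O[𝓝[>] 0 ⊔ atTop] fun t : ℝ => t ^ (α - 1) * lgdSlow α θ (1 / t) * min (t ^ (1 - α)) 1 := by
  refine IsBigO.sup ?_ ?_
  · have hone : (fun _ : ℝ => (1 : ℝ)) =O[𝓝[>] 0] fun _ : ℝ => θ / (θ + α) :=
      isBigO_const_const _ (show θ / (θ + α) ≠ 0 by positivity) _
    refine ((isBigO_lgdSpectralDensity_sub hα hα1 hθ).trans hone).congr' ?_ ?_
    all_goals
      filter_upwards [Ioo_mem_nhdsGT one_pos] with t ht
      rw [lgdSlow_of_one_lt α θ ((one_lt_div ht.1).2 ht.2)]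
    · ring
    · rw [min_eq_left (Real.rpow_le_one ht.1.le ht.2.le (by linarith)), mul_right_comm,
        ← Real.rpow_add ht.1, sub_add_sub_cancel, sub_self, Real.rpow_zero, one_mul]
  · have hmin : (fun t : ℝ => t ^ (α - 1) * lgdSlow α θ (1 / t)) =ᶠ[atTop]
        fun t : ℝ => t ^ (α - 1) * lgdSlow α θ (1 / t) * min (t ^ (1 - α)) 1 := by
      filter_upwards [eventually_ge_atTop 1] with t ht
      rw [min_eq_right (Real.one_le_rpow ht (by linarith)), mul_one]
    refine IsBigO.congr' ?_ EventuallyEq.rfl hmin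
    refine IsBigO.sub ?_ ?_
    · -- `t ^ (α - 1) * L (1 / t) = B (1 / t) / t`, and `B ≥ B 1` on `[0, 1]`
      refine (isBigO_lgdSpectralDensity_atTop hα hα1 hθ hθ1).trans
        (IsBigO.of_bound ((θ + α) / θ) ?_)
      filter_upwards [eventually_ge_atTop 1] with t ht
      have ht0 : 0 < t := by linarith
      have hB := le_lgdCovariance (r := 1 / t) hα hθ (by positivity) ((div_le_one ht0).2 ht)
      have heq : t ^ (α - 1) * lgdSlow α θ (1 / t) = 1 / t * lgdCovariance α θ (1 / t) := by
        have := (Real.rpow_pos_of_pos ht0 α).ne'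
        rw [lgdSlow, Real.div_rpow zero_le_one ht0.le, Real.one_rpow, Real.rpow_sub_one ht0.ne']
        field_simp
      rw [heq, Real.norm_of_nonneg (by positivity), Real.norm_of_nonneg
        (mul_nonneg (by positivity) (lgdCovariance_pos hα hθ (by positivity)).le)]
      calc 1 / t = (θ + α) / θ * (1 / t * (θ / (θ + α))) := by field_simp
        _ ≤ (θ + α) / θ * (1 / t * lgdCovariance α θ (1 / t)) := by gcongr
    · simp only [mul_assoc]
      exact (isBigO_refl _ _).const_mul_left _

/-! ### The two assumptions -/

theorem spectralAssumption_lgd {α θ : ℝ} (hα : 0 < α) (hα1 : α < 1) (hθ : 0 < θ) (hθ1 : θ ≤ 1)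
    {Ω : Type*} [MeasurableSpace Ω] {P : Measure Ω} {η : EuclideanSpace ℝ (Fin 1) → Ω → ℝ}
    (h : IsHomogeneousIsotropicField P η (lgdCovariance α θ)) {q : ℝ} (hq : 0 < q) (ν : ℝ) :
    SpectralAssumption P η (lgdCovariance α θ) (lgdSpectralDensity α θ) α (lgdSlow α θ)
      (1 - α) q ν where
  field := h
  density := isIsotropicSpectralDensity_lgd hα hα1 hθ hθ1
  expansion := by
    refine ⟨fun t => lgdSpectralDensity α θ t - cTwo 1 α * t ^ (α - 1) * lgdSlow α θ (1 / t),
      fun t _ => ?_, ?_⟩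
    · rw [Nat.cast_one]
      ring
    · rw [Nat.cast_one]
      exact lgdSpectralDensity_expansion hα hα1 hθ hθ1
  locallyBounded := isLocallyBoundedOnPos_lgdSlow hα hθ
  slowlyVarying := isSlowlyVarying_lgdSlow hα hθ
  upsilon_pos := by linarith
  q_pos := hq
  remainder := hasSlowVariationRemainder_lgdSlow hα hθ q ν

theorem covarianceAssumption_lgd {d : ℕ} {α θ : ℝ} (hα : 0 < α) (hθ : 0 < θ)
    {Ω : Type*} [MeasurableSpace Ω] {P : Measure Ω} {η : EuclideanSpace ℝ (Fin d) → Ω → ℝ}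
    (h : IsHomogeneousIsotropicField P η (lgdCovariance α θ)) (hG : IsGaussianProcess η P) :
    CovarianceAssumption P η (lgdCovariance α θ) α (lgdSlow α θ) where
  field := h
  gaussian := hG
  cov_zero := by simp [lgdCovariance, hθ.ne']
  cov_eq := fun r hr => by
    rw [lgdSlow, ← mul_assoc, ← Real.rpow_add hr, neg_add_cancel, Real.rpow_zero, one_mul]
  slowlyVarying := isSlowlyVarying_lgdSlow hα hθ

theorem mainTheorem6 :
    -- `d = 1, 2`: the first assumption and the remainder condition
    (∀ (d : ℕ) (α θ : ℝ), (d = 1 ∨ d = 2) → 0 < α → θ ∈ Set.Ioc (0 : ℝ) ((3 - (d : ℝ)) / 2) →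
      (∀ t : ℝ, 1 < t → lgdSlow α θ t = θ / (θ + α)) ∧
      (∀ q ν : ℝ, 0 < q → HasSlowVariationRemainder (lgdSlow α θ) q ν) ∧
      ∀ (Ω : Type*) [MeasurableSpace Ω] (P : Measure Ω) [IsProbabilityMeasure P]
        (η : EuclideanSpace ℝ (Fin d) → Ω → ℝ),
        IsHomogeneousIsotropicField P η (lgdCovariance α θ) → IsGaussianProcess η P →
          CovarianceAssumption P η (lgdCovariance α θ) α (lgdSlow α θ)) ∧
    -- `d = 1`, long memory
    (∀ α θ : ℝ, α ∈ Set.Ioo (0 : ℝ) (1 / 2) → θ ∈ Set.Ioc (0 : ℝ) 1 →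
      -- the explicit function is the (a.e. unique) spectral density of the covariance function
      (IsIsotropicSpectralDensity 1 (lgdCovariance α θ) (lgdSpectralDensity α θ) ∧
        ∀ g : ℝ → ℝ, IsIsotropicSpectralDensity 1 (lgdCovariance α θ) g →
          g =ᵐ[volume.restrict (Set.Ioi 0)] lgdSpectralDensity α θ) ∧
      -- behaviour at the origin
      Tendsto (fun t : ℝ => lgdSpectralDensity α θ t -
          θ * Real.Gamma (1 - α) * Real.sin (Real.pi * α / 2) / (Real.pi * (θ + α)) * t ^ (α - 1))
        (𝓝[>] 0) (𝓝 (α * θ / (Real.pi * (1 + θ) * (α - 1)))) ∧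
      (∃ ρ : ℝ → ℝ, ρ =O[𝓝[>] 0] (fun t : ℝ => t ^ (1 - α)) ∧
        ∀ t : ℝ, 0 < t →
          lgdSpectralDensity α θ t = cTwo 1 α * (θ / (θ + α)) * t ^ (α - 1) * (1 + ρ t)) ∧
      -- behaviour at infinity
      lgdSpectralDensity α θ =O[atTop] (fun t : ℝ => 1 / t) ∧
      -- the second assumption holds for every process with this covariance function
      ∀ (Ω : Type*) [MeasurableSpace Ω] (P : Measure Ω) [IsProbabilityMeasure P]
        (η : EuclideanSpace ℝ (Fin 1) → Ω → ℝ),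
        IsHomogeneousIsotropicField P η (lgdCovariance α θ) →
          ∀ q ν : ℝ, 0 < q →
            SpectralAssumption P η (lgdCovariance α θ) (lgdSpectralDensity α θ) α (lgdSlow α θ)
              (1 - α) q ν) := by
  refine ⟨fun d α θ _ hα hθ => ⟨fun t ht => lgdSlow_of_one_lt α θ ht,
    fun q ν _ => hasSlowVariationRemainder_lgdSlow hα hθ.1 q ν,
    fun Ω _ P _ η h hG => covarianceAssumption_lgd hα hθ.1 h hG⟩, fun α θ hα hθ => ?_⟩
  have hα1 : α < 1 := by linarith [hα.2]
  have hdens := isIsotropicSpectralDensity_lgd hα.1 hα1 hθ.1 hθ.2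
  exact ⟨⟨hdens, fun g hg => hg.ae_eq hdens⟩, tendsto_lgdSpectralDensity_sub hα.1 hα1 hθ.1,
    exists_lgdSpectralDensity_eq_mul_one_add hα.1 hα1 hθ.1,
    isBigO_lgdSpectralDensity_atTop hα.1 hα1 hθ.1 hθ.2,
    fun Ω _ P _ η h q ν hq => spectralAssumption_lgd hα.1 hα1 hθ.1 hθ.2 h hq ν⟩
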